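/- Let $n\ge 1$, let $\lambda=(\lambda_1\ge\cdots\ge\lambda_n\ge 0)$ be a partition with at most $n$ parts, let ${\bf x}=(x_1,\ldots,x_n)$ be indeterminates (or elements of a field for which the denominators below do not vanish, the field having characteristic different from $2$ in case 4), let $\overline{x}_i=x_i^{-1}$, and let ${\bf a}=(a_1,a_2,\ldots)$ be an arbitrary sequence of parameters. Put $(y|{\bf a})^m=(y+a_1)\cdots(y+a_m)$, with $(y|{\bf a})^0=1$. The factorial characters are the following ratios of $n\times n$ determinants, where the entry in row $i$ and column $j$ is displayed: $$gl_\lambda({\bf x}|{\bf a})=\frac{\left|(x_i|{\bf a})^{\lambda_j+n-j}\right|}{\left|(x_i|{\bf a})^{n-j}\right|},\qquad sp_\lambda({\bf x},\overline{\bf x}|{\bf a})=\frac{\left|x_i(x_i|{\bf a})^{\lambda_j+n-j}-\overline{x}_i(\overline{x}_i|{\bf a})^{\lambda_j+n-j}\right|}{\left|x_i(x_i|{\bf a})^{n-j}-\overline{x}_i(\overline{x}_i|{\bf a})^{n-j}\right|},$$ $$so_\lambda({\bf x},\overline{\bf x},1|{\bf a})=\frac{\left|x_i^{1/2}(x_i|{\bf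 a})^{\lambda_j+n-j}-\overline{x}_i^{1/2}(\overline{x}_i|{\bf a})^{\lambda_j+n-j}\right|}{\left|x_i^{1/2}(x_i|{\bf a})^{n-j}-\overline{x}_i^{1/2}(\overline{x}_i|{\bf a})^{n-j}\right|},\qquad o_\lambda({\bf x},\overline{\bf x}|{\bf a})=\frac{\eta\left|(x_i|{\bf a})^{\lambda_j+n-j}+(\overline{x}_i|{\bf a})^{\lambda_j+n-j}\right|}{\frac12\left|(x_i|{\bf a})^{n-j}+(\overline{x}_i|{\bf a})^{n-j}\right|},$$ where $\eta=\frac12$ if $\lambda_n=0$ and $\eta=1$ if $\lambda_n>0$. Fill each box $(i,j)$ (row $i$, column $j$) of the Young diagram $F^\lambda$ with an entry $T_{ij}$, and consider these conditions. (T1) Entries weakly increase from left to right along rows. (T2) Entries weakly increase from top to bottom down columns. (T3) No two identical entries appear in any column. (T4) Neither $k$ nor $\overline{k}$ appears lower than the $k$th row. (T5) At most one entry $0$ appears in any row. (T6) If an entry $k$ appears in the $k$th row, then any entry $\overline{k}$ in the same row has an entry $k$ immediately above it in the preceding row. Let - ${\cal T}^{gl}_\lambda$ be the set of fillings from $\{1<2<\cdots<n\}$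 satisfying (T1)-(T3); - ${\cal T}^{oo}_\lambda$ be the set of fillings from $\{1<\overline1<2<\overline2<\cdots<n<\overline n<0\}$ satisfying (T1), (T2), (T5), and (T3), (T4) for the nonzero entries; - ${\cal T}^{sp}_\lambda$ be the set of fillings from $\{1<\overline1<2<\overline2<\cdots<n<\overline n\}$ satisfying (T1)-(T4); - ${\cal T}^{eo}_\lambda$ be the set of fillings from $\{1<\overline1<2<\overline2<\cdots<n<\overline n\}$ satisfying (T1)-(T4) and (T6). Then, with $a_m=0$ for all $m\le 0$: 1. $gl_\lambda({\bf x}|{\bf a})=\sum_{T\in{\cal T}^{gl}_\lambda}\prod_{(i,j)\in F^\lambda}{\rm wgt}(T_{ij})$, where an entry $k$ in box $(i,j)$ has weight $x_k+a_{k+j-i}$. 2. $so_\lambda({\bf x},\overline{\bf x},1|{\bf a})=\sum_{T\in{\cal T}^{oo}_\lambda}\prod_{(i,j)\in F^\lambda}{\rm wgt}(T_{ij})$, where in box $(i,j)$ an entry $k$ has weight $x_k+a_{2k-n+j-i}$, an entry $\overline{k}$ has weight $\overline{x}_k+a_{2k+1-n+j-i}$, and an entry $0$ has weight $1-a_{n+1+j-i}$.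 3. $sp_\lambda({\bf x},\overline{\bf x}|{\bf a})=\sum_{T\in{\cal T}^{sp}_\lambda}\prod_{(i,j)\in F^\lambda}{\rm wgt}(T_{ij})$, where in box $(i,j)$ an entry $k$ has weight $x_k+a_{2k-1-n+j-i}$ and an entry $\overline{k}$ has weight $\overline{x}_k+a_{2k-n+j-i}$. 4. $o_\lambda({\bf x},\overline{\bf x}|{\bf a})=\sum_{T\in{\cal T}^{eo}_\lambda}2^{\zeta(T)}\prod_{(i,j)\in F^\lambda}{\rm wgt}(T_{ij})$, where in box $(i,j)$ an entry $k$ has weight $x_k+a_{2k-1-n+j-i+\delta_{ik}}$ and an entry $\overline{k}$ has weight $\overline{x}_k+a_{2k-n+j-i}$, and $\zeta(T)$ is the number of $k$ with $T_{k-1,1}=k$ and $T_{k,1}=\overline{k}$. -/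

import Mathlib

namespace FactorialCharacter

/-! ### Factorial parameters and factorial powers -/

section Factorial

variable {K : Type*} [Field K]

/-- The sequence `a = (a_1, a_2, …)` extended to all integer indices by `a_m = 0` for `m ≤ 0`. -/
def ext (a : ℕ+ → K) (m : ℤ) : K :=
  if h : 0 < m then a ⟨m.toNat, by omega⟩ else 0

/-- The factorial power `(y|a)^m = (y + a_1)(y + a_2)⋯(y + a_m)`, with `(y|a)^0 = 1`. -/
def facPow (y : K) (a : ℕ+ → K) (m : ℕ) : K :=
  ∏ r ∈ Finset.range m, (y + a r.succPNat)

end Factorial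

/-! ### Factorial characters

Partitions are Young diagrams `μ`; the part `λ_j` is `μ.rowLen (j - 1)`, and the length of the
partition is `μ.colLen 0`. Matrix indices `i j : Fin n` are zero-based, so that the exponent
`λ_j + n - j` of the column with index `j` is `μ.rowLen j + (n - 1 - j)`, where `j ≤ n - 1`. -/

section Characters

variable {K : Type*} [Field K] {n : ℕ}

/-- The factorial character `gl_λ(x|a)`. -/
noncomputable def gl (μ : YoungDiagram) (x : Fin n → K) (a : ℕ+ → K) : K :=
  (Matrix.of fun i j : Fin n => facPow (x i) a (μ.rowLen j + (n - 1 - j))).det /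
    (Matrix.of fun i j : Fin n => facPow (x i) a (n - 1 - j)).det

/-- The factorial character `sp_λ(x, x̄|a)`, where `x̄_i = x_i⁻¹`. -/
noncomputable def sp (μ : YoungDiagram) (x : Fin n → K) (a : ℕ+ → K) : K :=
  (Matrix.of fun i j : Fin n =>
      x i * facPow (x i) a (μ.rowLen j + (n - 1 - j)) -
        (x i)⁻¹ * facPow (x i)⁻¹ a (μ.rowLen j + (n - 1 - j))).det /
    (Matrix.of fun i j : Fin n =>
      x i * facPow (x i) a (n - 1 - j) - (x i)⁻¹ * facPow (x i)⁻¹ a (n - 1 - j)).det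

/-- The factorial character `so_λ(x, x̄, 1|a)`, where `x̄_i = x_i⁻¹`. The argument `s` supplies the
square roots `s_i = x_i^{1/2}`, and `x̄_i^{1/2} = s_i⁻¹`. -/
noncomputable def so (μ : YoungDiagram) (x s : Fin n → K) (a : ℕ+ → K) : K :=
  (Matrix.of fun i j : Fin n =>
      s i * facPow (x i) a (μ.rowLen j + (n - 1 - j)) -
        (s i)⁻¹ * facPow (x i)⁻¹ a (μ.rowLen j + (n - 1 - j))).det /
    (Matrix.of fun i j : Fin n =>
      s i * facPow (x i) a (n - 1 - j) - (s i)⁻¹ * facPow (x i)⁻¹ a (n - 1 - j)).det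

/-- The factorial character `o_λ(x, x̄|a)`, where `x̄_i = x_i⁻¹`; the numerator carries the factor
`η = 1/2` if `λ_n = 0` and `η = 1` if `λ_n > 0`. -/
noncomputable def o (μ : YoungDiagram) (x : Fin n → K) (a : ℕ+ → K) : K :=
  ((if μ.rowLen (n - 1) = 0 then 1 / 2 else 1) *
    (Matrix.of fun i j : Fin n =>
      facPow (x i) a (μ.rowLen j + (n - 1 - j)) +
        facPow (x i)⁻¹ a (μ.rowLen j + (n - 1 - j))).det) /
    (1 / 2 * (Matrix.of fun i j : Fin n =>
      facPow (x i) a (n - 1 - j) + facPow (x i)⁻¹ a (n - 1 - j)).det)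

end Characters

/-! ### Alphabets -/

/-- The alphabet `1 < 1̄ < 2 < 2̄ < ⋯ < n < n̄`. The letter with number `k + 1` is `(k, false)` when
it is unbarred and `(k, true)` when it is barred. -/
abbrev Letter (n : ℕ) : Type := Fin n ×ₗ Bool

namespace Letter

variable {n : ℕ}

/-- The unbarred letter with number `k + 1`. -/
def plain (k : Fin n) : Letter n := toLex (k, false)

/-- The barred letter with number `k + 1`. -/
def bar (k : Fin n) : Letter n := toLex (k, true)

/-- The index `k` of an unbarred or barred letter, whose number is `k + 1`. -/
def idx (z : Letter n) : Fin n := (ofLex z).1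

/-- Whether the letter is barred. -/
def isBar (z : Letter n) : Bool := (ofLex z).2

end Letter

/-- The alphabet `1 < 1̄ < 2 < 2̄ < ⋯ < n < n̄ < 0`, whose greatest letter `⊤` is the letter `0`. -/
abbrev OddLetter (n : ℕ) : Type := WithTop (Letter n)

/-! ### Tableaux -/

/-- The one-based row number of a box. -/
def row {μ : YoungDiagram} (c : μ.cells) : ℕ := c.1.1 + 1

/-- The one-based column number of a box. -/
def col {μ : YoungDiagram} (c : μ.cells) : ℕ := c.1.2 + 1

/-- A filling of the boxes of `μ` with letters from the alphabet `A`. -/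
abbrev Filling (μ : YoungDiagram) (A : Type) : Type := μ.cells → A

section Tableaux

variable {μ : YoungDiagram} {A : Type} [LinearOrder A] {n : ℕ}

/-- Entries weakly increase from left to right across rows. -/
def T1 (T : Filling μ A) : Prop :=
  ∀ c d : μ.cells, row c = row d → col c ≤ col d → T c ≤ T d

/-- Entries weakly increase from top to bottom down columns. -/
def T2 (T : Filling μ A) : Prop :=
  ∀ c d : μ.cells, col c = col d → row c ≤ row d → T c ≤ T d

/-- No two identical entries appear in any column. -/
def T3 (T : Filling μ A) : Prop :=
  ∀ c d : μ.cells, col c = col d → row c ≠ row d → T c ≠ T d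

/-- Neither `k` nor `k̄` appears lower than the `k`th row. -/
def T4 (T : Filling μ (Letter n)) : Prop :=
  ∀ c : μ.cells, row c ≤ ((T c).idx : ℕ) + 1

/-- No two identical nonzero entries appear in any column. -/
def T3Odd (T : Filling μ (OddLetter n)) : Prop :=
  ∀ c d : μ.cells, col c = col d → row c ≠ row d → T c ≠ ⊤ → T c ≠ T d

/-- Neither `k` nor `k̄` appears lower than the `k`th row, for nonzero entries. -/
def T4Odd (T : Filling μ (OddLetter n)) : Prop :=
  ∀ (c : μ.cells) (z : Letter n), T c = (z : OddLetter n) → row c ≤ (z.idx : ℕ) + 1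

/-- At most one entry `0` appears in any row. -/
def T5 (T : Filling μ (OddLetter n)) : Prop :=
  ∀ c d : μ.cells, row c = row d → T c = ⊤ → T d = ⊤ → c = d

/-- If an entry `k` appears in the `k`th row then any entry `k̄` in the same row is covered by an
entry `k` immediately above it in the preceding row. -/
def T6 (T : Filling μ (Letter n)) : Prop :=
  ∀ k : Fin n, (∃ b : μ.cells, row b = (k : ℕ) + 1 ∧ T b = Letter.plain k) →
    ∀ c : μ.cells, row c = (k : ℕ) + 1 → T c = Letter.bar k →
      ∃ d : μ.cells, row d + 1 = row c ∧ col d = col c ∧ T d = Letter.plain k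

end Tableaux

open Classical in
/-- Semistandard tableaux of shape `μ` in the alphabet `1 < 2 < ⋯ < n`, with `k : Fin n` standing for
the letter `k + 1`. -/
noncomputable def glTableaux (μ : YoungDiagram) (n : ℕ) : Finset (Filling μ (Fin n)) :=
  {T | T1 T ∧ T2 T ∧ T3 T}

open Classical in
/-- Symplectic tableaux of shape `μ`. -/
noncomputable def spTableaux (μ : YoungDiagram) (n : ℕ) : Finset (Filling μ (Letter n)) :=
  {T | T1 T ∧ T2 T ∧ T3 T ∧ T4 T}

open Classical in
/-- Odd orthogonal tableaux of shape `μ`. -/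
noncomputable def ooTableaux (μ : YoungDiagram) (n : ℕ) : Finset (Filling μ (OddLetter n)) :=
  {T | T1 T ∧ T2 T ∧ T3Odd T ∧ T4Odd T ∧ T5 T}

open Classical in
/-- Even orthogonal tableaux of shape `μ`. -/
noncomputable def eoTableaux (μ : YoungDiagram) (n : ℕ) : Finset (Filling μ (Letter n)) :=
  {T | T1 T ∧ T2 T ∧ T3 T ∧ T4 T ∧ T6 T}

open Classical in
/-- `ζ(T)`: the number of `k` such that `T_{k-1,1} = k` and `T_{k,1} = k̄`. -/
noncomputable def zeta {μ : YoungDiagram} {n : ℕ} (T : Filling μ (Letter n)) : ℕ :=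
  Finset.card {k : Fin n | ∃ c d : μ.cells, col c = 1 ∧ col d = 1 ∧
    row c = (k : ℕ) ∧ row d = (k : ℕ) + 1 ∧ T c = Letter.plain k ∧ T d = Letter.bar k}

/-! ### Factorial weights

The letter with index `k : Fin n` has number `k + 1`; below this number is written out, so that
`i = row c`, `j = col c`, and for instance `a_{2k-n+j-i}` becomes
`ext a (2 * (k + 1) - n + col c - row c)`. -/

section Weights

variable {K : Type*} [Field K] {n : ℕ} {μ : YoungDiagram}

/-- `x_k + a_{k+j-i}`. -/
def glWeight (x : Fin n → K) (a : ℕ+ → K) (c : μ.cells) (k : Fin n) : K :=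
  x k + ext a (((k : ℤ) + 1) + col c - row c)

/-- `x_k + a_{2k-1-n+j-i}` for the letter `k`, and `x̄_k + a_{2k-n+j-i}` for the letter `k̄`. -/
def spWeight (x : Fin n → K) (a : ℕ+ → K) (c : μ.cells) (z : Letter n) : K :=
  if z.isBar then
    (x z.idx)⁻¹ + ext a (2 * ((z.idx : ℤ) + 1) - n + col c - row c)
  else
    x z.idx + ext a (2 * ((z.idx : ℤ) + 1) - 1 - n + col c - row c)

/-- `x_k + a_{2k-n+j-i}` for the letter `k`, `x̄_k + a_{2k+1-n+j-i}` for the letter `k̄`, and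
`1 - a_{n+1+j-i}` for the letter `0`. -/
def ooWeight (x : Fin n → K) (a : ℕ+ → K) (c : μ.cells) : OddLetter n → K :=
  WithTop.recTopCoe (1 - ext a ((n : ℤ) + 1 + col c - row c)) fun z =>
    if z.isBar then
      (x z.idx)⁻¹ + ext a (2 * ((z.idx : ℤ) + 1) + 1 - n + col c - row c)
    else
      x z.idx + ext a (2 * ((z.idx : ℤ) + 1) - n + col c - row c)

/-- `x_k + a_{2k-1-n+j-i+δ_{ik}}` for the letter `k`, and `x̄_k + a_{2k-n+j-i}` for the
letter `k̄`. -/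
def eoWeight (x : Fin n → K) (a : ℕ+ → K) (c : μ.cells) (z : Letter n) : K :=
  if z.isBar then
    (x z.idx)⁻¹ + ext a (2 * ((z.idx : ℤ) + 1) - n + col c - row c)
  else
    x z.idx + ext a (2 * ((z.idx : ℤ) + 1) - 1 - n + col c - row c +
      (if row c = (z.idx : ℕ) + 1 then 1 else 0))

end Weights

end FactorialCharacter

/-!
Each character is a ratio of alternants `|f_i(λ_j + n - j)|`, and each sum over tableaux is computed
by removing the boxes that hold the greatest letter, which form a horizontal strip (a vertical strip
for the letter `0`). The two sides satisfy the same recursion.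

On the side of determinants, suppose that `f_i(m) = g_i(m) + w(m) f_i(m - 1)` with `w(m)` independent
of `i`. Column operations and multilinearity expand the alternant of the `f_i` as a sum over the
shapes obtained from `λ` by removing a horizontal strip, with the alternants of the `g_i` as
coefficients, and the weight of the strip is the product of the values of `w` at its boxes
(`alternant_eq_sum_hstrips`). The factorial power `(x_i|a)^m` satisfies such a recurrence with
`w(m) = x_n + a_m` and `g_i(m) = (x_i - x_n) (x_i|a)^{m-1}`. Here `g_n(m) = 0` for `m > 0`, so that the
alternant of the `g_i` vanishes unless the shape has fewer than `n` rows, and then it is a multiple of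
the alternant in `x_1, …, x_{n-1}` (`alternant_succ_eq`). This is the branching rule of `gl`.

For the symplectic and orthogonal characters two such steps, for the letters `n̄` and `n`, replace
`f_i(m)` by `(x_i + x̄_i - x_n - x̄_n) f'_i(m - 1)`, where `f'` is formed with the sequence
`(0, a_1, a_2, …)`; this accounts for the dependence of the weights on `n`. In the odd orthogonal case
the letter `0` is removed beforehand by `alternant_eq_sum_vstrips`, which leaves the symplectic
alternant for an unshifted sequence. In the even orthogonal case the weights produced by the two
steps differ in the last row from those of the tableaux, where also the covering condition and the
factor `2 ^ ζ(T)` intervene. But if one fixes the shape formed by the letters below `n` and all rows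
but the last of the shape formed by the letters below `n̄`, the sums over the length of the
remaining row agree (`sum_evenMult`, `sum_lastRow`, `sum_hstrips_hstrips_congr`).

In all cases the alternant for `λ`, after a common factor has been taken out of each row, is a product
of differences, which does not depend on `λ` and does not vanish, times the sum over tableaux; for the
empty partition the sum is `1`.
-/

namespace FactorialCharacter

/-! ### Subdiagrams and strips -/

section Strips

variable {K : Type*} [Field K]

theorem finite_setOf_le (μ : YoungDiagram) : {ν : YoungDiagram | ν ≤ μ}.Finite := by
  refine Set.Finite.of_finite_image (f := YoungDiagram.cells) ?_ ?_
  · refine (μ.cells.powerset.finite_toSet).subset ?_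
    rintro _ ⟨ν, hν, rfl⟩
    simpa using YoungDiagram.cells_subset_iff.2 hν
  · intro ν _ κ _ h
    exact YoungDiagram.ext h

/-- The Young diagrams contained in `μ`. -/
noncomputable def subdiagrams (μ : YoungDiagram) : Finset YoungDiagram :=
  (finite_setOf_le μ).toFinset

@[simp]
theorem mem_subdiagrams {μ ν : YoungDiagram} : ν ∈ subdiagrams μ ↔ ν ≤ μ := by
  simp [subdiagrams]

open Classical in
/-- The subdiagrams `ν` of `μ` for which `μ / ν` is a horizontal strip, that is, has at most one box
in each column. -/
noncomputable def hstrips (μ : YoungDiagram) : Finset YoungDiagram :=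
  {ν ∈ subdiagrams μ | ∀ i c, (i + 1, c) ∈ μ → (i, c) ∈ ν}

open Classical in
/-- The subdiagrams `ν` of `μ` for which `μ / ν` is a vertical strip, that is, has at most one box
in each row. -/
noncomputable def vstrips (μ : YoungDiagram) : Finset YoungDiagram :=
  {ν ∈ subdiagrams μ | ∀ i c, (i, c + 1) ∈ μ → (i, c) ∈ ν}

theorem mem_hstrips {μ ν : YoungDiagram} :
    ν ∈ hstrips μ ↔ ν ≤ μ ∧ ∀ i c, (i + 1, c) ∈ μ → (i, c) ∈ ν := by
  simp [hstrips]

theorem mem_vstrips {μ ν : YoungDiagram} :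
    ν ∈ vstrips μ ↔ ν ≤ μ ∧ ∀ i c, (i, c + 1) ∈ μ → (i, c) ∈ ν := by
  simp [vstrips]

theorem le_iff_rowLen {μ ν : YoungDiagram} : ν ≤ μ ↔ ∀ i, ν.rowLen i ≤ μ.rowLen i := by
  constructor
  · intro h i
    by_contra! hlt
    have := h (YoungDiagram.mem_iff_lt_rowLen.2 hlt)
    exact lt_irrefl _ (YoungDiagram.mem_iff_lt_rowLen.1 this)
  · rintro h ⟨i, c⟩ hc
    exact YoungDiagram.mem_iff_lt_rowLen.2
      ((YoungDiagram.mem_iff_lt_rowLen.1 hc).trans_le (h i))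

theorem eq_of_rowLen {μ ν : YoungDiagram} (h : ∀ i, ν.rowLen i = μ.rowLen i) : ν = μ :=
  le_antisymm (le_iff_rowLen.2 fun i => (h i).le) (le_iff_rowLen.2 fun i => (h i).ge)

theorem mem_hstrips_iff_rowLen {μ ν : YoungDiagram} :
    ν ∈ hstrips μ ↔ ∀ i, μ.rowLen (i + 1) ≤ ν.rowLen i ∧ ν.rowLen i ≤ μ.rowLen i := by
  rw [mem_hstrips, le_iff_rowLen, forall_and, and_comm]
  refine and_congr_left fun _ => forall_congr' fun i => ?_
  simp only [YoungDiagram.mem_iff_lt_rowLen]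
  exact ⟨fun h => by by_contra! hlt; exact lt_irrefl _ (h _ hlt), fun h c hc => hc.trans_le h⟩

theorem mem_vstrips_iff_rowLen {μ ν : YoungDiagram} :
    ν ∈ vstrips μ ↔ ∀ i, μ.rowLen i ≤ ν.rowLen i + 1 ∧ ν.rowLen i ≤ μ.rowLen i := by
  rw [mem_vstrips, le_iff_rowLen, forall_and, and_comm]
  refine and_congr_left fun _ => forall_congr' fun i => ?_
  simp only [YoungDiagram.mem_iff_lt_rowLen]
  exact ⟨fun h => by by_contra! hlt; exact lt_irrefl _ (h _ hlt), fun h c hc => by omega⟩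

theorem rowLen_eq_zero_of_le {μ : YoungDiagram} {n i : ℕ} (h : μ.rowLen n = 0) (hi : n ≤ i) :
    μ.rowLen i = 0 :=
  Nat.le_zero.1 (h ▸ μ.rowLen_anti n i hi)

theorem rowLen_eq_zero_iff {μ : YoungDiagram} {n : ℕ} : μ.rowLen n = 0 ↔ μ.colLen 0 ≤ n := by
  have h : 0 < μ.rowLen n ↔ n < μ.colLen 0 :=
    YoungDiagram.mem_iff_lt_rowLen.symm.trans YoungDiagram.mem_iff_lt_colLen
  omega

theorem fst_lt_of_mem {μ : YoungDiagram} {n : ℕ} (h : μ.rowLen n = 0) {c : ℕ × ℕ}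
    (hc : c ∈ μ) : c.1 < n := by
  by_contra! hlt
  have := YoungDiagram.mem_iff_lt_rowLen.1 (show (c.1, c.2) ∈ μ from hc)
  simp [rowLen_eq_zero_of_le h hlt] at this

theorem rowLen_eq_zero_of_mem_hstrips {μ ν : YoungDiagram} {n : ℕ} (hν : ν ∈ hstrips μ)
    (h : μ.rowLen n = 0) : ν.rowLen n = 0 :=
  Nat.le_zero.1 (h ▸ (mem_hstrips_iff_rowLen.1 hν n).2)

theorem rowLen_bot (i : ℕ) : (⊥ : YoungDiagram).rowLen i = 0 := by
  by_contra h
  exact YoungDiagram.notMem_bot _ (YoungDiagram.mem_iff_lt_rowLen.2 (Nat.pos_of_ne_zero h))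

/-- The diagram with rows of lengths `κ 0 ≥ κ 1 ≥ ⋯`; if `κ` is not antitone, its running minimum is
taken instead. -/
def ofRows {n : ℕ} (κ : Fin n → ℕ) : YoungDiagram where
  cells := {c ∈ Finset.range n ×ˢ Finset.range (∑ i, κ i) | ∀ i : Fin n, i ≤ c.1 → c.2 < κ i}
  isLowerSet := by
    rintro ⟨a, b⟩ ⟨a', b'⟩ ⟨h1, h2⟩ h
    simp only [Finset.coe_filter, Finset.mem_product, Finset.mem_range, Set.mem_ofPred_eq] at h ⊢
    simp only at h1 h2
    exact ⟨⟨by omega, by omega⟩, fun i hi => lt_of_le_of_lt h2 (h.2 i (hi.trans h1))⟩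

theorem mem_ofRows {n : ℕ} {κ : Fin n → ℕ} (hκ : Antitone κ) {i c : ℕ} :
    (i, c) ∈ ofRows κ ↔ ∃ h : i < n, c < κ ⟨i, h⟩ := by
  change (i, c) ∈ (ofRows κ).cells ↔ _
  simp only [ofRows, Finset.mem_filter, Finset.mem_product, Finset.mem_range]
  constructor
  · rintro ⟨⟨h, -⟩, h'⟩
    exact ⟨h, h' ⟨i, h⟩ le_rfl⟩
  · rintro ⟨h, h'⟩
    refine ⟨⟨h, h'.trans_le ?_⟩, fun j hj => h'.trans_le (hκ hj)⟩
    exact Finset.single_le_sum (f := κ) (fun _ _ => Nat.zero_le _) (Finset.mem_univ _)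

theorem rowLen_ofRows {n : ℕ} {κ : Fin n → ℕ} (hκ : Antitone κ) (i : Fin n) :
    (ofRows κ).rowLen i = κ i := by
  refine eq_of_forall_lt_iff fun c => ?_
  rw [← YoungDiagram.mem_iff_lt_rowLen, mem_ofRows hκ]
  simp

theorem rowLen_ofRows_of_le {n : ℕ} {κ : Fin n → ℕ} (hκ : Antitone κ) {i : ℕ} (hi : n ≤ i) :
    (ofRows κ).rowLen i = 0 := by
  by_contra h
  have := YoungDiagram.mem_iff_lt_rowLen.2 (Nat.pos_of_ne_zero h)
  rw [mem_ofRows hκ] at this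
  exact absurd this.1 (by omega)

theorem ofRows_rowLen {μ : YoungDiagram} {n : ℕ} (h : μ.rowLen n = 0) :
    ofRows (fun j : Fin n => μ.rowLen j) = μ := by
  have hanti : Antitone fun j : Fin n => μ.rowLen j := fun a b hab => μ.rowLen_anti _ _ hab
  refine eq_of_rowLen fun i => ?_
  rcases lt_or_ge i n with hi | hi
  · exact rowLen_ofRows hanti ⟨i, hi⟩
  · rw [rowLen_ofRows_of_le hanti hi, rowLen_eq_zero_of_le h hi]

theorem antitone_of_interlacing {μ : YoungDiagram} {n : ℕ} {κ : Fin n → ℕ}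
    (h : ∀ j : Fin n, κ j ∈ Finset.Icc (μ.rowLen (j + 1)) (μ.rowLen j)) : Antitone κ := by
  intro a b hab
  rcases hab.eq_or_lt with rfl | hab
  · rfl
  · exact ((Finset.mem_Icc.1 (h b)).2.trans (μ.rowLen_anti _ _ hab)).trans
      (Finset.mem_Icc.1 (h a)).1

/-- Removing a horizontal strip from `μ` amounts to choosing row lengths that interlace with those
of `μ`. -/
theorem sum_hstrips {μ : YoungDiagram} {n : ℕ} (hμ : μ.rowLen n = 0) (Φ : YoungDiagram → K) :
    ∑ ν ∈ hstrips μ, Φ ν =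
      ∑ κ ∈ Fintype.piFinset fun j : Fin n => Finset.Icc (μ.rowLen (j + 1)) (μ.rowLen j),
        Φ (ofRows κ) := by
  refine Finset.sum_bij' (fun ν _ => fun j : Fin n => ν.rowLen j) (fun κ _ => ofRows κ)
    ?_ ?_ ?_ ?_ ?_
  · intro ν hν
    simpa [Fintype.mem_piFinset] using fun j : Fin n => mem_hstrips_iff_rowLen.1 hν j
  · intro κ hκ
    rw [Fintype.mem_piFinset] at hκ
    have hanti := antitone_of_interlacing hκ
    rw [mem_hstrips_iff_rowLen]
    intro i
    rcases lt_or_ge i n with hi | hi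
    · have := rowLen_ofRows hanti ⟨i, hi⟩
      simp only at this
      rw [this]
      exact Finset.mem_Icc.1 (hκ ⟨i, hi⟩)
    · rw [rowLen_ofRows_of_le hanti hi, rowLen_eq_zero_of_le hμ (hi.trans (Nat.le_succ i))]
      simp
  · intro ν hν
    exact ofRows_rowLen (rowLen_eq_zero_of_mem_hstrips hν hμ)
  · intro κ hκ
    rw [Fintype.mem_piFinset] at hκ
    funext j
    exact rowLen_ofRows (antitone_of_interlacing hκ) j
  · intro ν hν
    rw [ofRows_rowLen (rowLen_eq_zero_of_mem_hstrips hν hμ)]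

/-- A product over the boxes of a skew diagram, taken row by row. -/
theorem prod_sdiff_eq {μ ν : YoungDiagram} {n : ℕ} (hμ : μ.rowLen n = 0) (w : ℕ × ℕ → K) :
    ∏ c ∈ μ.cells \ ν.cells, w c =
      ∏ j : Fin n, ∏ c ∈ Finset.Ico (ν.rowLen j) (μ.rowLen j), w (j, c) := by
  rw [Finset.prod_sigma']
  symm
  refine Finset.prod_bij (fun p _ => ((p.1 : ℕ), p.2)) ?_ ?_ ?_ ?_
  · rintro ⟨j, c⟩ h
    simp only [Finset.mem_sigma, Finset.mem_univ, Finset.mem_Ico, true_and] at h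
    simp only [Finset.mem_sdiff, YoungDiagram.mem_cells, YoungDiagram.mem_iff_lt_rowLen]
    omega
  · rintro ⟨j, c⟩ - ⟨j', c'⟩ - h
    simp only [Prod.mk.injEq] at h
    obtain ⟨h1, rfl⟩ := h
    rw [Fin.ext h1]
  · rintro ⟨i, c⟩ h
    have hi := fst_lt_of_mem hμ ((YoungDiagram.mem_cells _).1 (Finset.mem_sdiff.1 h).1)
    simp only [Finset.mem_sdiff, YoungDiagram.mem_cells, YoungDiagram.mem_iff_lt_rowLen] at h
    refine ⟨⟨⟨i, hi⟩, c⟩, ?_, rfl⟩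
    simp only [Finset.mem_sigma, Finset.mem_univ, Finset.mem_Ico, true_and]
    omega
  · intros
    rfl

end Strips

/-! ### Expanding alternants along strips -/

section Alternants

variable {K : Type*} [Field K]

/-- The alternant `|f_i(λ_j + n - j)|` of the sequences `f_1, …, f_n`, for the partition `λ` whose
parts are the row lengths of `μ`. -/
def alternant (n : ℕ) (f : ℕ → ℕ → K) (μ : YoungDiagram) : K :=
  (Matrix.of fun i j : Fin n => f i (μ.rowLen j + (n - 1 - j))).det

theorem alternant_mul {n : ℕ} (d : ℕ → K) (f : ℕ → ℕ → K) (μ : YoungDiagram) :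
    alternant n (fun i m => d i * f i m) μ = (∏ i : Fin n, d i) * alternant n f μ :=
  Matrix.det_mul_column (fun i : Fin n => d i) _

theorem det_sum_col {n : ℕ} (I : Fin n → Finset ℕ) (G : Fin n → ℕ → Fin n → K) :
    (Matrix.of fun i j : Fin n => ∑ k ∈ I j, G j k i).det =
      ∑ k ∈ Fintype.piFinset I, (Matrix.of fun i j : Fin n => G j (k j) i).det := by
  have h := (Matrix.detRowAlternating (n := Fin n) (R := K)).toMultilinearMap.map_sum_finset
    (A := I) (g := G)
  have e (M : Fin n → Fin n → K) :
      (Matrix.detRowAlternating (n := Fin n) (R := K)).toMultilinearMap M =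
        (Matrix.of fun i j : Fin n => M j i).det := by
    rw [← Matrix.det_transpose]
    rfl
  simp only [e] at h
  rw [← h]
  congr 1
  ext i j
  simp

theorem add_le_add_of_strictAnti {n : ℕ} {l : Fin n → ℕ} (hl : StrictAnti l) {i j : Fin n}
    (hij : i ≤ j) : l j + j ≤ l i + i := by
  have key : ∀ d : ℕ, ∀ h : (i : ℕ) + d < n, l ⟨i + d, h⟩ + d ≤ l i := by
    intro d
    induction d with
    | zero => intro h; exact le_rfl
    | succ d ih =>
      intro h
      have h1 := ih (by omega)
      have h2 : l ⟨i + (d + 1), h⟩ < l ⟨i + d, by omega⟩ := hl (Fin.mk_lt_mk.2 (by omega))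
      omega
  have hij' : (i : ℕ) ≤ j := hij
  have h := key (j - i) (by omega)
  have e : (⟨i + (j - i), by omega⟩ : Fin n) = j := Fin.ext (by simp; omega)
  rw [e] at h
  omega

theorem det_eq_of_forall_col_eq_smul_add_succ {n : ℕ} {A B : Matrix (Fin (n + 1)) (Fin (n + 1)) K}
    (c : Fin n → K) (hlast : ∀ i, A i (Fin.last n) = B i (Fin.last n))
    (hcast : ∀ i (j : Fin n), A i j.castSucc = B i j.castSucc + c j * A i j.succ) :
    A.det = B.det := by
  rw [← Matrix.det_submatrix_equiv_self Fin.revPerm A,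
    ← Matrix.det_submatrix_equiv_self Fin.revPerm B]
  refine Matrix.det_eq_of_forall_col_eq_smul_add_pred (fun j => c j.rev) ?_ ?_
  · intro i
    simpa using hlast _
  · intro i j
    have := hcast i.rev j.rev
    simpa [Fin.rev_succ, Fin.rev_castSucc] using this

/-- The recurrence iterated from `q + e + 1` down to `p + e`. In the row with `e + 1` rows below it,
of length `q`, where the next row has length `p`, this expresses the entry of one column by the entry
of the next one and an interlacing sum. -/
theorem eq_sum_of_recurrence {f g w : ℕ → K} (hf : ∀ m, f (m + 1) = g (m + 1) + w (m + 1) * f m)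
    (e p q : ℕ) (hpq : p ≤ q) :
    f (q + (e + 1)) = ∑ l ∈ Finset.Icc p q,
        (∏ c ∈ Finset.Ico l q, w (c + 1 + (e + 1))) * g (l + (e + 1)) +
      (∏ c ∈ Finset.Ico p (q + 1), w (c + 1 + e)) * f (p + e) := by
  induction q, hpq using Nat.le_induction with
  | base =>
    have := hf (p + e)
    simp only [Finset.Icc_self, Finset.sum_singleton, Finset.Ico_self, Finset.prod_empty, one_mul,
      Nat.Ico_succ_singleton, Finset.prod_singleton]
    rw [← add_assoc, this, show p + 1 + e = p + e + 1 by ring]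
  | succ q hpq ih =>
    have h := hf (q + e + 1)
    have hprod : ∏ c ∈ Finset.Ico p (q + 1 + 1), w (c + 1 + e) =
        w (q + e + 2) * ∏ c ∈ Finset.Ico p (q + 1), w (c + 1 + e) := by
      rw [Finset.prod_Ico_succ_top (by omega), mul_comm, show q + 1 + 1 + e = q + e + 2 by ring]
    have hsum : ∑ l ∈ Finset.Icc p q, (∏ c ∈ Finset.Ico l (q + 1), w (c + 1 + (e + 1))) *
        g (l + (e + 1)) = w (q + e + 2) * ∑ l ∈ Finset.Icc p q,
        (∏ c ∈ Finset.Ico l q, w (c + 1 + (e + 1))) * g (l + (e + 1)) := by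
      rw [Finset.mul_sum]
      refine Finset.sum_congr rfl fun l hl => ?_
      rw [Finset.prod_Ico_succ_top (Finset.mem_Icc.1 hl).2,
        show q + 1 + (e + 1) = q + e + 2 by ring]
      ring
    rw [← add_assoc] at ih
    rw [← Finset.insert_Icc_right_eq_Icc_add_one (by omega), Finset.sum_insert (by simp), hprod,
      hsum, show q + 1 + (e + 1) = q + e + 1 + 1 by ring, h, ih]
    simp
    ring

theorem eq_sum_of_recurrence_zero {f g w : ℕ → K} (h0 : f 0 = g 0)
    (hf : ∀ m, f (m + 1) = g (m + 1) + w (m + 1) * f m) (q : ℕ) :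
    f q = ∑ l ∈ Finset.Icc 0 q, (∏ c ∈ Finset.Ico l q, w (c + 1)) * g l := by
  induction q with
  | zero => simp [h0]
  | succ q ih =>
    rw [← Finset.insert_Icc_right_eq_Icc_add_one (by omega), Finset.sum_insert (by simp), hf, ih,
      Finset.mul_sum]
    congr 1
    · simp
    · refine Finset.sum_congr rfl fun l hl => ?_
      rw [Finset.prod_Ico_succ_top (Finset.mem_Icc.1 hl).2]
      ring

/-- If `f_i(m) = g_i(m) + w(m) f_i(m - 1)`, then the alternant of the `f_i` expands over horizontal
strips into alternants of the `g_i`. Subtracting from each column the multiple of the next one that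
the recurrence provides, one is left in each column with a sum over an interval whose end points are
consecutive row lengths. -/
theorem alternant_eq_sum_hstrips {n : ℕ} {f g : ℕ → ℕ → K} {w : ℕ → K}
    (h0 : ∀ i < n, f i 0 = g i 0)
    (hf : ∀ i < n, ∀ m, f i (m + 1) = g i (m + 1) + w (m + 1) * f i m)
    {μ : YoungDiagram} (hμ : μ.rowLen n = 0) :
    alternant n f μ = ∑ ν ∈ hstrips μ,
      (∏ c ∈ μ.cells \ ν.cells, w (c.2 + 1 + (n - 1 - c.1))) * alternant n g ν := by
  rw [sum_hstrips hμ]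
  set I : Fin n → Finset ℕ := fun j => Finset.Icc (μ.rowLen (j + 1)) (μ.rowLen j)
  have hR : ∀ κ ∈ Fintype.piFinset I,
      (∏ c ∈ μ.cells \ (ofRows κ).cells, w (c.2 + 1 + (n - 1 - c.1))) *
        alternant n g (ofRows κ) =
      (Matrix.of fun i j : Fin n => (∏ c ∈ Finset.Ico (κ j) (μ.rowLen j), w (c + 1 + (n - 1 - j))) *
        g i (κ j + (n - 1 - j))).det := by
    intro κ hκ
    rw [Fintype.mem_piFinset] at hκ
    have hanti := antitone_of_interlacing hκ
    rw [prod_sdiff_eq hμ]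
    simp only [rowLen_ofRows hanti]
    rw [alternant, ← Matrix.det_mul_row]
    simp only [rowLen_ofRows hanti]
    rfl
  rw [Finset.sum_congr rfl hR, ← det_sum_col I fun j k i =>
    (∏ c ∈ Finset.Ico k (μ.rowLen j), w (c + 1 + (n - 1 - j))) * g i (k + (n - 1 - j))]
  rcases n with _ | n
  · simp [alternant]
  refine det_eq_of_forall_col_eq_smul_add_succ
    (fun j => ∏ c ∈ Finset.Ico (μ.rowLen (j + 1)) (μ.rowLen j + 1), w (c + 1 + (n - 1 - j))) ?_ ?_
  · intro i
    simp only [Matrix.of_apply, Fin.val_last, add_tsub_cancel_right, tsub_self, add_zero, I, hμ]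
    exact eq_sum_of_recurrence_zero (h0 i i.2) (hf i i.2) _
  · intro i j
    have hj : n + 1 - 1 - (j : ℕ) = n - 1 - j + 1 := by omega
    have hj' : n + 1 - 1 - ((j : ℕ) + 1) = n - 1 - j := by omega
    simp only [Matrix.of_apply, I, Fin.val_castSucc, Fin.val_succ]
    simp only [hj, hj']
    exact eq_sum_of_recurrence (hf i i.2) (n - 1 - j) _ _ (μ.rowLen_anti _ _ (by omega))

/-- If `f_i(m) = g_i(m) + v(m) g_i(m - 1)`, then the alternant of the `f_i` expands over vertical
strips into alternants of the `g_i`; the terms in which two rows become too close to each other have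
two equal columns. -/
theorem alternant_eq_sum_vstrips {n : ℕ} {f g : ℕ → ℕ → K} {v : ℕ → K}
    (h0 : ∀ i < n, f i 0 = g i 0)
    (hf : ∀ i < n, ∀ m, f i (m + 1) = g i (m + 1) + v (m + 1) * g i m)
    {μ : YoungDiagram} (hμ : μ.rowLen n = 0) :
    alternant n f μ = ∑ ν ∈ vstrips μ,
      (∏ c ∈ μ.cells \ ν.cells, v (c.2 + 1 + (n - 1 - c.1))) * alternant n g ν := by
  set b : Fin n → ℕ := fun j => μ.rowLen j + (n - 1 - j) with hb
  have hbanti : ∀ i j : Fin n, i < j → b j < b i := fun i j hij => by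
    have h1 := μ.rowLen_anti i j hij.le
    have h2 : (i : ℕ) < j := hij
    simp only [hb]
    omega
  set I : Fin n → Finset ℕ := fun j => Finset.Icc (b j - 1) (b j)
  have hL : alternant n f μ = ∑ l ∈ Fintype.piFinset I, (Matrix.of fun i j : Fin n =>
      (∏ r ∈ Finset.Ico (l j) (b j), v (r + 1)) * g i (l j)).det := by
    rw [← det_sum_col I fun j k i => (∏ r ∈ Finset.Ico k (b j), v (r + 1)) * g i k, alternant]
    congr 1
    ext i j
    simp only [Matrix.of_apply, I]
    change f i (b j) = _
    rcases b j with _ | m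
    · simp [h0 i i.2]
    · rw [hf i i.2, ← Finset.insert_Icc_right_eq_Icc_add_one (by omega),
        Finset.sum_insert (by simp)]
      simp
  rw [hL]
  symm
  have hdef : ∀ ν ∈ vstrips μ, ∀ j : Fin n, μ.rowLen j ≤ ν.rowLen j + 1 ∧ ν.rowLen j ≤ μ.rowLen j :=
    fun ν hν j => mem_vstrips_iff_rowLen.1 hν j
  refine Finset.sum_of_injOn (fun ν => fun j : Fin n => ν.rowLen j + (n - 1 - j)) ?_ ?_ ?_ ?_
  · intro ν hν κ hκ h
    refine eq_of_rowLen fun i => ?_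
    rcases lt_or_ge i n with hi | hi
    · simpa using congr_fun h ⟨i, hi⟩
    · have h1 := (mem_vstrips_iff_rowLen.1 hν i).2
      have h2 := (mem_vstrips_iff_rowLen.1 hκ i).2
      rw [rowLen_eq_zero_of_le hμ hi] at h1 h2
      omega
  · intro ν hν
    simp only [Finset.mem_coe, Fintype.mem_piFinset, Finset.mem_Icc, I, hb]
    intro j
    have := hdef ν hν j
    omega
  · intro l hl hnot
    rw [Fintype.mem_piFinset] at hl
    by_contra hdet
    have hanti : StrictAnti l := by
      intro i j hij
      have h1 := Finset.mem_Icc.1 (hl i)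
      have h2 := Finset.mem_Icc.1 (hl j)
      have h3 := hbanti i j hij
      refine lt_of_le_of_ne (by omega) fun heq => hdet ?_
      refine (Matrix.det_mul_row (fun j : Fin n => ∏ r ∈ Finset.Ico (l j) (b j), v (r + 1))
        (Matrix.of fun i j : Fin n => g i (l j))).trans ?_
      rw [Matrix.det_zero_of_column_eq hij.ne (fun k => by simp [heq]), mul_zero]
    have hge : ∀ j : Fin n, n - 1 - j ≤ l j := fun j => by
      have hj := j.2
      have h := add_le_add_of_strictAnti hanti (i := j) (j := ⟨n - 1, by omega⟩)
        (show (j : ℕ) ≤ n - 1 by omega)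
      simp only at h
      omega
    set κ : Fin n → ℕ := fun j => l j - (n - 1 - j) with hκ
    have hκanti : Antitone κ := fun i j hij => by
      have h := add_le_add_of_strictAnti hanti hij
      have h1 := hge i
      have h2 := hge j
      have h3 : (i : ℕ) ≤ j := hij
      simp only [hκ]
      omega
    refine hnot ⟨ofRows κ, ?_, ?_⟩
    · rw [Finset.mem_coe, mem_vstrips_iff_rowLen]
      intro i
      rcases lt_or_ge i n with hi | hi
      · have h : (ofRows κ).rowLen i = l ⟨i, hi⟩ - (n - 1 - i) := rowLen_ofRows hκanti ⟨i, hi⟩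
        have h1 : μ.rowLen i + (n - 1 - i) - 1 ≤ l ⟨i, hi⟩ ∧ l ⟨i, hi⟩ ≤ μ.rowLen i + (n - 1 - i) :=
          Finset.mem_Icc.1 (hl ⟨i, hi⟩)
        have h2 : n - 1 - i ≤ l ⟨i, hi⟩ := hge ⟨i, hi⟩
        omega
      · rw [rowLen_ofRows_of_le hκanti hi, rowLen_eq_zero_of_le hμ hi]
        simp
    · funext j
      have h2 := hge j
      have h3 : (ofRows κ).rowLen j = l j - (n - 1 - j) := rowLen_ofRows hκanti j
      simp only
      omega
  · intro ν hν
    rw [prod_sdiff_eq hμ, alternant, ← Matrix.det_mul_row]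
    congr 1
    ext i j
    simp only [Matrix.of_apply]
    congr 1
    rw [← Finset.prod_Ico_add' (fun r => v (r + 1)) _ _ (n - 1 - (j : ℕ))]
    exact Finset.prod_congr rfl fun c _ => by rw [add_right_comm]

/-- If the last of the sequences vanishes away from `0`, the alternant reduces to one of smaller
size. -/
theorem alternant_succ_eq {n : ℕ} {g : ℕ → ℕ → K} (hg : ∀ m, g n (m + 1) = 0)
    (μ : YoungDiagram) :
    alternant (n + 1) g μ =
      if μ.rowLen n = 0 then g n 0 * alternant n (fun i m => g i (m + 1)) μ else 0 := by
  have hz : ∀ j : Fin n, g n (μ.rowLen j + (n - j)) = 0 := fun j => by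
    rw [show μ.rowLen j + (n - j) = μ.rowLen j + (n - 1 - j) + 1 by omega]
    exact hg _
  rw [alternant, Matrix.det_succ_row _ (Fin.last n), Fin.sum_univ_castSucc,
    Finset.sum_eq_zero fun j _ => by simp [hz], zero_add]
  split_ifs with h
  · simp only [Fin.val_last, Even.add_self, Even.neg_pow, one_pow, one_mul, Matrix.of_apply,
      add_tsub_cancel_right, tsub_self, add_zero, h, Fin.succAbove_last, alternant]
    congr 2
    ext i j
    simp only [Matrix.submatrix_apply, Matrix.of_apply, Fin.val_castSucc]
    congr 1
    omega
  · obtain ⟨m, hm⟩ := Nat.exists_eq_succ_of_ne_zero h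
    simp [hm, hg]

end Alternants

/-! ### Tableaux with letters coded by natural numbers -/

section CodedTableaux

variable {K : Type*} [Field K] {μ ν : YoungDiagram}

theorem T1_and_T2_iff {A : Type} [LinearOrder A] {T : Filling μ A} :
    T1 T ∧ T2 T ↔ ∀ c d : μ.cells, c.1 ≤ d.1 → T c ≤ T d := by
  constructor
  · rintro ⟨h1, h2⟩ ⟨⟨i, j⟩, hc⟩ ⟨⟨i', j'⟩, hd⟩ ⟨hi, hj⟩
    simp only at hi hj
    have he : (i, j') ∈ μ.cells := μ.isLowerSet (show (i, j') ≤ (i', j') from ⟨hi, le_rfl⟩) hd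
    exact (h1 ⟨_, hc⟩ ⟨_, he⟩ rfl (Nat.succ_le_succ hj)).trans
      (h2 ⟨_, he⟩ ⟨_, hd⟩ rfl (Nat.succ_le_succ hi))
  · intro h
    refine ⟨fun c d hr hc => h c d ⟨?_, ?_⟩, fun c d hc hr => h c d ⟨?_, ?_⟩⟩ <;>
      simp only [row, col] at hr hc <;> omega

open Classical in
/-- The fillings of `μ` with letters `0, 1, …, N - 1` that increase weakly along rows and down
columns. -/
noncomputable def monoFillings (μ : YoungDiagram) (N : ℕ) : Finset (Filling μ ℕ) :=
  {T ∈ Fintype.piFinset fun _ => Finset.range N | T1 T ∧ T2 T}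

theorem mem_monoFillings {N : ℕ} {T : Filling μ ℕ} :
    T ∈ monoFillings μ N ↔ (∀ c, T c < N) ∧ ∀ c d : μ.cells, c.1 ≤ d.1 → T c ≤ T d := by
  simp only [monoFillings, Finset.mem_filter, Fintype.mem_piFinset, Finset.mem_range, T1_and_T2_iff]

/-- The filling of `μ` that extends a filling of the subdiagram `ν` by the letter `N`. -/
def extendBy (μ : YoungDiagram) (N : ℕ) (T : Filling ν ℕ) : Filling μ ℕ :=
  fun c => if h : c.1 ∈ ν.cells then T ⟨c.1, h⟩ else N

theorem extendBy_of_mem {N : ℕ} {T : Filling ν ℕ} {c : μ.cells} (h : c.1 ∈ ν.cells) :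
    extendBy μ N T c = T ⟨c.1, h⟩ := dif_pos h

theorem extendBy_of_notMem {N : ℕ} {T : Filling ν ℕ} {c : μ.cells} (h : c.1 ∉ ν.cells) :
    extendBy μ N T c = N := dif_neg h

/-- The diagram formed by the boxes with letters below `N` in a weakly increasing filling. For other
fillings, a box counts only if all boxes to its north-west have letters below `N`. -/
def below (N : ℕ) (T : Filling μ ℕ) : YoungDiagram where
  cells := {c ∈ μ.cells | ∀ d : μ.cells, d.1 ≤ c → T d < N}
  isLowerSet := by
    intro c c' hle h
    simp only [Finset.coe_filter, Set.mem_ofPred_eq] at h ⊢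
    exact ⟨μ.isLowerSet hle h.1, fun d hd => h.2 d (hd.trans hle)⟩

theorem mem_below {N M : ℕ} {T : Filling μ ℕ} (hT : T ∈ monoFillings μ M) {c : ℕ × ℕ} :
    c ∈ (below N T).cells ↔ ∃ h : c ∈ μ.cells, T ⟨c, h⟩ < N := by
  simp only [below, Finset.mem_filter]
  constructor
  · rintro ⟨h, h'⟩
    exact ⟨h, h' ⟨c, h⟩ le_rfl⟩
  · rintro ⟨h, h'⟩
    exact ⟨h, fun d hd => ((mem_monoFillings.1 hT).2 d ⟨c, h⟩ hd).trans_lt h'⟩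

theorem extendBy_mem_monoFillings {N : ℕ} {T : Filling ν ℕ} (hT : T ∈ monoFillings ν N) :
    extendBy μ N T ∈ monoFillings μ (N + 1) := by
  rw [mem_monoFillings] at hT ⊢
  constructor
  · intro c
    by_cases h : c.1 ∈ ν.cells
    · rw [extendBy_of_mem h]
      exact (hT.1 _).trans (Nat.lt_succ_self N)
    · rw [extendBy_of_notMem h]
      exact Nat.lt_succ_self N
  · intro c d hcd
    by_cases h : d.1 ∈ ν.cells
    · rw [extendBy_of_mem h, extendBy_of_mem (ν.isLowerSet hcd h)]
      exact hT.2 _ _ hcd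
    · rw [extendBy_of_notMem h]
      by_cases h' : c.1 ∈ ν.cells
      · rw [extendBy_of_mem h']
        exact (hT.1 _).le
      · rw [extendBy_of_notMem h']

/-- A weakly increasing filling is obtained from its boxes with letters below `N` by filling the
remaining boxes with the greatest letter `N`. -/
theorem sum_monoFillings_succ (N : ℕ) (F : Filling μ ℕ → K) :
    ∑ T ∈ monoFillings μ (N + 1), F T =
      ∑ ν ∈ subdiagrams μ, ∑ T ∈ monoFillings ν N, F (extendBy μ N T) := by
  classical
  have hmaps : ∀ T ∈ monoFillings μ (N + 1), below N T ∈ subdiagrams μ := by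
    intro T hT
    rw [mem_subdiagrams, ← YoungDiagram.cells_subset_iff]
    exact Finset.filter_subset _ _
  rw [← Finset.sum_fiberwise_of_maps_to hmaps]
  refine Finset.sum_congr rfl fun ν hν => ?_
  have hsub : ν.cells ⊆ μ.cells := YoungDiagram.cells_subset_iff.2 (mem_subdiagrams.1 hν)
  have hback : ∀ T ∈ (monoFillings μ (N + 1)).filter (fun T => below N T = ν),
      extendBy μ N (fun c : ν.cells => T ⟨c.1, hsub c.2⟩) = T := by
    intro T hT
    rw [Finset.mem_filter] at hT
    funext c
    by_cases h : c.1 ∈ ν.cells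
    · rw [extendBy_of_mem h]
    · rw [extendBy_of_notMem h]
      have h1 := (mem_monoFillings.1 hT.1).1 c
      rw [← hT.2, mem_below hT.1] at h
      have h2 : ¬ T c < N := fun hlt => h ⟨c.2, hlt⟩
      omega
  refine Finset.sum_bij' (fun T _ => fun c : ν.cells => T ⟨c.1, hsub c.2⟩)
    (fun T _ => extendBy μ N T) ?_ ?_ hback ?_ ?_
  · intro T hT
    rw [Finset.mem_filter] at hT
    rw [mem_monoFillings]
    refine ⟨fun c => ?_, fun c d hcd => (mem_monoFillings.1 hT.1).2 _ _ hcd⟩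
    have hc : c.1 ∈ (below N T).cells := hT.2 ▸ c.2
    exact ((mem_below hT.1).1 hc).2
  · intro T hT
    rw [Finset.mem_filter]
    refine ⟨extendBy_mem_monoFillings hT, ?_⟩
    refine YoungDiagram.ext (Finset.ext fun c => ?_)
    rw [mem_below (extendBy_mem_monoFillings hT)]
    constructor
    · rintro ⟨h, hlt⟩
      by_contra hc
      rw [extendBy_of_notMem (c := ⟨c, h⟩) hc] at hlt
      exact lt_irrefl _ hlt
    · intro h
      refine ⟨hsub h, ?_⟩
      rw [extendBy_of_mem (c := ⟨c, hsub h⟩) h]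
      exact (mem_monoFillings.1 hT).1 _
  · intro T hT
    funext c
    exact extendBy_of_mem (c := ⟨c.1, hsub c.2⟩) c.2
  · intro T hT
    rw [hback T hT]

theorem T3_extendBy {N : ℕ} (hνμ : ν ≤ μ) {T : Filling ν ℕ} (hT : T ∈ monoFillings ν N) :
    T3 (extendBy μ N T) ↔ ν ∈ hstrips μ ∧ T3 T := by
  have hlt := (mem_monoFillings.1 hT).1
  have hsub : ν.cells ⊆ μ.cells := YoungDiagram.cells_subset_iff.2 hνμ
  rw [mem_hstrips]
  constructor
  · intro h
    refine ⟨⟨hνμ, fun i c hc => ?_⟩, fun c d hcol hrow heq => ?_⟩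
    · by_contra hic
      have hic' : (i, c) ∈ μ.cells :=
        μ.isLowerSet (show (i, c) ≤ (i + 1, c) from ⟨Nat.le_succ i, le_rfl⟩) hc
      have hsucc : (i + 1, c) ∉ ν.cells := fun h' =>
        hic (ν.isLowerSet (show (i, c) ≤ (i + 1, c) from ⟨Nat.le_succ i, le_rfl⟩) h')
      refine h ⟨(i, c), hic'⟩ ⟨(i + 1, c), hc⟩ rfl (by simp [row]) ?_
      rw [extendBy_of_notMem hic, extendBy_of_notMem hsucc]
    · refine h ⟨c.1, hsub c.2⟩ ⟨d.1, hsub d.2⟩ hcol hrow ?_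
      rw [extendBy_of_mem (c := ⟨c.1, hsub c.2⟩) c.2, extendBy_of_mem (c := ⟨d.1, hsub d.2⟩) d.2]
      exact heq
  · rintro ⟨⟨-, hstrip⟩, h3⟩
    have key : ∀ c d : μ.cells, col c = col d → row c < row d → c.1 ∈ ν.cells := by
      rintro ⟨⟨i, j⟩, hc⟩ ⟨⟨i', j'⟩, hd⟩ hcol hrow
      simp only [col, row] at hcol hrow
      obtain rfl : j = j' := by omega
      exact hstrip i j (μ.isLowerSet (show (i + 1, j) ≤ (i', j) from ⟨by simp; omega, le_rfl⟩) hd)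
    intro c d hcol hrow heq
    by_cases hc : c.1 ∈ ν.cells <;> by_cases hd : d.1 ∈ ν.cells
    · rw [extendBy_of_mem hc, extendBy_of_mem hd] at heq
      exact h3 ⟨c.1, hc⟩ ⟨d.1, hd⟩ hcol hrow heq
    · rw [extendBy_of_mem hc, extendBy_of_notMem hd] at heq
      exact (hlt _).ne heq
    · rw [extendBy_of_notMem hc, extendBy_of_mem hd] at heq
      exact (hlt _).ne heq.symm
    · rcases lt_or_gt_of_ne hrow with h | h
      · exact hc (key c d hcol h)
      · exact hd (key d c hcol.symm h)

theorem prod_extendBy {N : ℕ} (hνμ : ν ≤ μ) (T : Filling ν ℕ) (w : ℕ → ℕ × ℕ → K) :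
    ∏ c, w (extendBy μ N T c) c.1 =
      (∏ c ∈ μ.cells \ ν.cells, w N c) * ∏ c, w (T c) c.1 := by
  have hsub : ν.cells ⊆ μ.cells := YoungDiagram.cells_subset_iff.2 hνμ
  set φ : ℕ × ℕ → K := fun p => if h : p ∈ ν.cells then w (T ⟨p, h⟩) p else w N p with hφ
  have h1 : ∏ c : μ.cells, w (extendBy μ N T c) c.1 = ∏ p ∈ μ.cells, φ p := by
    rw [← Finset.prod_coe_sort μ.cells φ]
    refine Finset.prod_congr rfl fun c _ => ?_
    by_cases h : c.1 ∈ ν.cells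
    · simp only [hφ, extendBy, dif_pos h]
    · simp only [hφ, extendBy, dif_neg h]
  have h2 : ∏ c : ν.cells, w (T c) c.1 = ∏ p ∈ ν.cells, φ p := by
    rw [← Finset.prod_coe_sort ν.cells φ]
    refine Finset.prod_congr rfl fun c _ => ?_
    simp only [hφ, dif_pos c.2]
  have h3 : ∏ c ∈ μ.cells \ ν.cells, w N c = ∏ p ∈ μ.cells \ ν.cells, φ p := by
    refine Finset.prod_congr rfl fun c hc => ?_
    simp only [hφ, dif_neg (Finset.mem_sdiff.1 hc).2]
  rw [h1, h2, h3, Finset.prod_sdiff hsub]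

open Classical in
/-- The weighted sum over the semistandard tableaux of shape `μ` with letters `0, 1, …, N - 1`, where
`w m (i, j)` is the weight of the letter `m` in the box `(i, j)`. -/
noncomputable def ssytSum (w : ℕ → ℕ × ℕ → K) (N : ℕ) (μ : YoungDiagram) : K :=
  ∑ T ∈ monoFillings μ N, if T3 T then ∏ c, w (T c) c.1 else 0

theorem ssytSum_succ (w : ℕ → ℕ × ℕ → K) (N : ℕ) (μ : YoungDiagram) :
    ssytSum w (N + 1) μ =
      ∑ ν ∈ hstrips μ, (∏ c ∈ μ.cells \ ν.cells, w N c) * ssytSum w N ν := by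
  classical
  rw [ssytSum, sum_monoFillings_succ]
  have hsub : hstrips μ ⊆ subdiagrams μ := Finset.filter_subset _ _
  rw [← Finset.sum_subset hsub]
  · refine Finset.sum_congr rfl fun ν hν => ?_
    have hνμ := (mem_hstrips.1 hν).1
    rw [ssytSum, Finset.mul_sum]
    refine Finset.sum_congr rfl fun T hT => ?_
    simp only [T3_extendBy hνμ hT, hν, true_and, prod_extendBy hνμ T w, mul_ite, mul_zero]
  · intro ν hν hν'
    refine Finset.sum_eq_zero fun T hT => ?_
    rw [if_neg]
    rw [T3_extendBy (mem_subdiagrams.1 hν) hT]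
    exact fun h => hν' h.1

theorem ssytSum_congr {w w' : ℕ → ℕ × ℕ → K} {N : ℕ} (h : ∀ m < N, ∀ c, w m c = w' m c)
    (μ : YoungDiagram) : ssytSum w N μ = ssytSum w' N μ := by
  refine Finset.sum_congr rfl fun T hT => ?_
  congr 1
  exact Finset.prod_congr rfl fun c _ => h _ ((mem_monoFillings.1 hT).1 c) _

theorem ssytSum_eq_zero {w : ℕ → ℕ × ℕ → K} {N : ℕ} {μ : YoungDiagram} {c : ℕ × ℕ} (hc : c ∈ μ)
    (h : ∀ m < N, w m c = 0) : ssytSum w N μ = 0 := by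
  refine Finset.sum_eq_zero fun T hT => ?_
  rw [Finset.prod_eq_zero (Finset.mem_univ ⟨c, hc⟩) (h _ ((mem_monoFillings.1 hT).1 _)), ite_self]

instance isEmpty_cells_bot : IsEmpty (⊥ : YoungDiagram).cells :=
  ⟨fun c => YoungDiagram.notMem_bot _ c.2⟩

theorem monoFillings_bot (N : ℕ) : monoFillings ⊥ N = Finset.univ := by
  refine Finset.ext fun T => ?_
  rw [mem_monoFillings]
  simp only [Finset.mem_univ, iff_true]
  exact ⟨fun c => isEmptyElim c, fun c => isEmptyElim c⟩

theorem ssytSum_bot (w : ℕ → ℕ × ℕ → K) (N : ℕ) : ssytSum w N ⊥ = 1 := by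
  have h3 (T : Filling ⊥ ℕ) : T3 T := fun c => isEmptyElim c
  rw [ssytSum, monoFillings_bot, Fintype.sum_unique, if_pos (h3 _), Finset.univ_eq_empty,
    Finset.prod_empty]

/-- Renaming letters by an increasing bijection onto `{0, 1, …, N - 1}`. -/
theorem sum_eq_sum_monoFillings {A : Type} [LinearOrder A] {code : A → ℕ} (hcode : StrictMono code)
    {N : ℕ} (hN : ∀ m, m < N ↔ ∃ z, code z = m) (P : Filling μ A → Prop) [DecidablePred P]
    {s : Finset (Filling μ A)} (hs : ∀ T, T ∈ s ↔ (T1 T ∧ T2 T) ∧ P T)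
    (G : Filling μ A → K) (F : Filling μ ℕ → K)
    (hF : ∀ T, T1 T ∧ T2 T → F (fun c => code (T c)) = if P T then G T else 0) :
    ∑ T ∈ s, G T = ∑ T ∈ monoFillings μ N, F T := by
  refine Finset.sum_of_injOn (fun T => fun c => code (T c)) ?_ ?_ ?_ ?_
  · intro T _ T' _ h
    funext c
    exact hcode.injective (congr_fun h c)
  · intro T hT
    rw [Finset.mem_coe, hs, T1_and_T2_iff] at hT
    rw [Finset.mem_coe, mem_monoFillings]
    exact ⟨fun c => (hN _).2 ⟨_, rfl⟩, fun c d h => hcode.monotone (hT.1 c d h)⟩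
  · intro T hT hnot
    rw [mem_monoFillings] at hT
    choose T' hT' using fun c => (hN _).1 (hT.1 c)
    have hTT' : (fun c => code (T' c)) = T := funext hT'
    have hmono : T1 T' ∧ T2 T' := by
      rw [T1_and_T2_iff]
      intro c d h
      have := hT.2 c d h
      rwa [← hT', ← hT', hcode.le_iff_le] at this
    rw [← hTT', hF T' hmono, if_neg]
    intro hP
    exact hnot ⟨T', Finset.mem_coe.2 ((hs T').2 ⟨hmono, hP⟩), hTT'⟩
  · intro T hT
    have := (hs T).1 hT
    simp only [hF T this.1, if_pos this.2]

end CodedTableaux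

/-! ### Factorial powers -/

section Recurrences

variable {K : Type*} [Field K]

/-- The factorial power `(y|A)^m = (y + A_1)⋯(y + A_m)` for a sequence indexed by `ℤ`. -/
def facPowInt (A : ℤ → K) (y : K) (m : ℕ) : K :=
  ∏ r ∈ Finset.range m, (y + A (r + 1))

@[simp]
theorem facPowInt_zero (A : ℤ → K) (y : K) : facPowInt A y 0 = 1 := by
  simp [facPowInt]

theorem facPowInt_succ (A : ℤ → K) (y : K) (m : ℕ) :
    facPowInt A y (m + 1) = facPowInt A y m * (y + A (m + 1)) :=
  Finset.prod_range_succ _ _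

theorem facPowInt_ext (a : ℕ+ → K) (y : K) (m : ℕ) : facPowInt (ext a) y m = facPow y a m := by
  refine Finset.prod_congr rfl fun r _ => ?_
  rw [ext, dif_pos (by omega)]
  rfl

theorem ext_of_nonpos (a : ℕ+ → K) {r : ℤ} (hr : r ≤ 0) : ext a r = 0 :=
  dif_neg (not_lt.2 hr)

/-- The sequence `A` moved by one place, so that `A_0` becomes the first parameter. -/
def shift (A : ℤ → K) (r : ℤ) : K := A (r - 1)

theorem shift_of_nonpos {A : ℤ → K} (hA : ∀ r ≤ 0, A r = 0) (r : ℤ) (hr : r ≤ 0) :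
    shift A r = 0 := hA _ (by omega)

theorem facPowInt_shift {A : ℤ → K} (hA : A 0 = 0) (y : K) (m : ℕ) :
    facPowInt (shift A) y (m + 1) = y * facPowInt A y m := by
  rw [facPowInt, Finset.prod_range_succ', mul_comm]
  simp [shift, hA, facPowInt]

theorem eq_bot_of_rowLen_zero {μ : YoungDiagram} (h : μ.rowLen 0 = 0) : μ = ⊥ :=
  eq_of_rowLen fun i => by rw [rowLen_bot, rowLen_eq_zero_of_le h (Nat.zero_le i)]

/-- The sequence `1, f 0, f 1, …`. -/
def delay (f : ℕ → K) : ℕ → K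
  | 0 => 1
  | m + 1 => f m

@[simp]
theorem delay_zero (f : ℕ → K) : delay f 0 = 1 := rfl

@[simp]
theorem delay_succ (f : ℕ → K) (m : ℕ) : delay f (m + 1) = f m := rfl

/-! ### The general linear alternant -/

/-- The weight `x_{m+1} + a_{m+1+j-i}` of the letter `m + 1` in the box `(i, j)`. It is set to zero
below row `m + 1`, where this letter cannot occur in a semistandard tableau. -/
def glCodeWeight (x : ℕ → K) (A : ℤ → K) (m : ℕ) (c : ℕ × ℕ) : K :=
  if c.1 ≤ m then x m + A ((m : ℤ) + 1 + c.2 - c.1) else 0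

/-- Induction on the number of variables: one horizontal strip is removed for the letter `n`. -/
theorem alternant_facPowInt (x : ℕ → K) (A : ℤ → K) (n : ℕ) (μ : YoungDiagram)
    (hμ : μ.rowLen n = 0) :
    alternant n (fun i m => facPowInt A (x i) m) μ =
      (∏ k ∈ Finset.range n, ∏ i ∈ Finset.range k, (x i - x k)) *
        ssytSum (glCodeWeight x A) n μ := by
  induction n generalizing μ with
  | zero => simp [eq_bot_of_rowLen_zero hμ, ssytSum_bot, alternant]
  | succ n ih =>
    set g : ℕ → ℕ → K := fun i m => delay (fun m => (x i - x n) * facPowInt A (x i) m) m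
    rw [alternant_eq_sum_hstrips (g := g) (w := fun r => x n + A r) (by simp [g])
      (fun i _ m => by simp only [g, delay_succ, facPowInt_succ]; push_cast; ring) hμ, ssytSum_succ,
      Finset.mul_sum]
    refine Finset.sum_congr rfl fun ν hν => ?_
    have hprod : ∏ c ∈ μ.cells \ ν.cells, (x n + A ((c.2 + 1 + (n + 1 - 1 - c.1) : ℕ) : ℤ)) =
        ∏ c ∈ μ.cells \ ν.cells, glCodeWeight x A n c := by
      refine Finset.prod_congr rfl fun c hc => ?_
      have := fst_lt_of_mem hμ ((YoungDiagram.mem_cells _).1 (Finset.mem_sdiff.1 hc).1)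
      rw [glCodeWeight, if_pos (by omega)]
      congr 2
      omega
    rw [hprod, alternant_succ_eq (g := g) (by simp [g])]
    split_ifs with h
    · simp only [g, delay_zero, delay_succ]
      rw [alternant_mul (fun i => x i - x n) (fun i m => facPowInt A (x i) m), ih ν h,
        Finset.prod_range_succ, Finset.prod_range (fun i => x i - x n)]
      ring
    · rw [ssytSum_eq_zero (c := (n, 0))
        (YoungDiagram.mem_iff_lt_rowLen.2 (Nat.pos_of_ne_zero h))
        fun m hm => by rw [glCodeWeight, if_neg (by simpa using hm)]]
      ring

/-! ### The symplectic alternant -/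

/-- The polynomial `((y|A)^{m+1} - (ȳ|A)^{m+1}) / (y - ȳ)` in `y` and `ȳ = y⁻¹`, defined by a
recurrence so that it makes sense for `y = ȳ` too. -/
def facHom (A : ℤ → K) (y : K) : ℕ → K
  | 0 => 1
  | m + 1 => (y⁻¹ + A (m + 2)) * facHom A y m + facPowInt A y (m + 1)

theorem sub_mul_facHom (A : ℤ → K) (y : K) (m : ℕ) :
    (y - y⁻¹) * facHom A y m = facPowInt A y (m + 1) - facPowInt A y⁻¹ (m + 1) := by
  induction m with
  | zero => simp [facHom, facPowInt]
  | succ m ih =>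
    rw [facHom, facPowInt_succ A y (m + 1), facPowInt_succ A y⁻¹ (m + 1)]
    push_cast
    rw [show (m : ℤ) + 1 + 1 = m + 2 by ring]
    linear_combination (y⁻¹ + A (m + 2)) * ih

theorem facHom_shift {A : ℤ → K} (hA : A 0 = 0) (y : K) (m : ℕ) :
    facHom (shift A) y (m + 1) = y⁻¹ * facHom A y m + facPowInt A y (m + 1) := by
  induction m with
  | zero => simp [facHom, facPowInt, shift, hA]; ring
  | succ m ih =>
    rw [facHom, ih, facPowInt_shift hA, facHom, facPowInt_succ A y (m + 1)]
    have : shift A ((m + 1 : ℕ) + 2) = A (m + 2) := by simp [shift]; congr 1; omega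
    rw [this]
    push_cast
    ring_nf

/-- The weights `x_k + a_{2k-n+j-i}` of the letter `k` and `x̄_k + a_{2k+1-n+j-i}` of the letter `k̄`
in the box `(i, j)`, for the letters `1, 1̄, 2, 2̄, …` coded by `0, 1, 2, 3, …`. They are set to zero
below row `k`. -/
def barWeight (x : ℕ → K) (A : ℤ → K) (n m : ℕ) (c : ℕ × ℕ) : K :=
  if c.1 ≤ m / 2 then
    if m % 2 = 0 then x (m / 2) + A (2 * ((m / 2 : ℕ) + 1) - n + c.2 - c.1)
    else (x (m / 2))⁻¹ + A (2 * ((m / 2 : ℕ) + 1) + 1 - n + c.2 - c.1)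
  else 0

/-- Induction on the number of variables: horizontal strips are removed for the letters `n̄` and `n`,
which leaves the alternant for `x_1, …, x_{n-1}` and the shifted sequence. -/
theorem alternant_facHom (x : ℕ → K) (n : ℕ) (hx : ∀ i < n, x i ≠ 0) (A : ℤ → K)
    (hA : ∀ r ≤ 0, A r = 0) (μ : YoungDiagram) (hμ : μ.rowLen n = 0) :
    alternant n (fun i m => facHom A (x i) m) μ =
      (∏ k ∈ Finset.range n, ∏ i ∈ Finset.range k, (x i + (x i)⁻¹ - (x k + (x k)⁻¹))) *
        ssytSum (barWeight x A n) (2 * n) μ := by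
  induction n generalizing A μ with
  | zero => simp [eq_bot_of_rowLen_zero hμ, ssytSum_bot, alternant]
  | succ n ih =>
    set D : ℕ → K := fun i => x i + (x i)⁻¹ - (x n + (x n)⁻¹) with hD
    set f : ℕ → ℕ → K := fun i m =>
      delay (fun m => ((x i)⁻¹ - (x n)⁻¹) * facHom A (x i) m + facPowInt A (x i) (m + 1)) m
      with hf
    set g : ℕ → ℕ → K := fun i m => delay (fun m => D i * facHom (shift A) (x i) m) m with hg
    have hfg : ∀ i < n + 1, ∀ m, f i (m + 1) = g i (m + 1) + (x n + A ((m + 1 : ℕ) : ℤ)) * f i m := by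
      intro i hi m
      rcases m with _ | m
      · simp only [hf, hg, hD, delay_zero, delay_succ, facHom, facPowInt]
        simp
        ring
      · have h1 := mul_inv_cancel₀ (hx i hi)
        have h2 := mul_inv_cancel₀ (hx n (Nat.lt_succ_self n))
        simp only [hf, hg, hD, delay_succ]
        rw [facHom_shift (hA 0 le_rfl), facHom, facPowInt_succ A (x i) (m + 1)]
        push_cast
        rw [show (m : ℤ) + 1 + 1 = m + 2 by ring]
        linear_combination (facHom A (x i) m) * (h2 - h1)
    rw [alternant_eq_sum_hstrips (g := f) (w := fun r => (x n)⁻¹ + A (r + 1))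
      (by simp [f, facHom])
      (fun i _ m => by simp only [f, facHom, delay_succ]; push_cast; ring_nf) hμ,
      show 2 * (n + 1) = 2 * n + 1 + 1 by ring, ssytSum_succ, Finset.mul_sum]
    refine Finset.sum_congr rfl fun ν hν => ?_
    have hνn := rowLen_eq_zero_of_mem_hstrips hν hμ
    have hprod : ∏ c ∈ μ.cells \ ν.cells,
        ((x n)⁻¹ + A ((c.2 + 1 + (n + 1 - 1 - c.1) : ℕ) + 1 : ℤ)) =
        ∏ c ∈ μ.cells \ ν.cells, barWeight x A (n + 1) (2 * n + 1) c := by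
      refine Finset.prod_congr rfl fun c hc => ?_
      have := fst_lt_of_mem hμ ((YoungDiagram.mem_cells _).1 (Finset.mem_sdiff.1 hc).1)
      have h2 : (2 * n + 1) / 2 = n := by omega
      rw [barWeight, h2, if_pos (by omega), if_neg (by omega)]
      congr 2
      omega
    rw [hprod, alternant_eq_sum_hstrips (g := g) (w := fun r => x n + A r) (by simp [f, g])
      hfg hνn, ssytSum_succ, Finset.mul_sum, Finset.mul_sum, Finset.mul_sum]
    refine Finset.sum_congr rfl fun κ hκ => ?_
    have hprod' : ∏ c ∈ ν.cells \ κ.cells, (x n + A ((c.2 + 1 + (n + 1 - 1 - c.1) : ℕ) : ℤ)) =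
        ∏ c ∈ ν.cells \ κ.cells, barWeight x A (n + 1) (2 * n) c := by
      refine Finset.prod_congr rfl fun c hc => ?_
      have := fst_lt_of_mem hνn ((YoungDiagram.mem_cells _).1 (Finset.mem_sdiff.1 hc).1)
      have h2 : (2 * n) / 2 = n := by omega
      rw [barWeight, h2, if_pos (by omega), if_pos (by omega)]
      congr 2
      omega
    rw [hprod', alternant_succ_eq (g := g) (by simp [g, D])]
    split_ifs with h
    · have hC : ∏ i ∈ Finset.range n, (x i + (x i)⁻¹ - (x n + (x n)⁻¹)) = ∏ i : Fin n, D i :=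
        Finset.prod_range _
      simp only [g, delay_zero, delay_succ]
      rw [alternant_mul D (fun i m => facHom (shift A) (x i) m),
        ih (fun i hi => hx i (by omega)) (shift A) (shift_of_nonpos hA) κ h,
        Finset.prod_range_succ, hC,
        ssytSum_congr (w := barWeight x (shift A) n) (w' := barWeight x A (n + 1))]
      · ring
      · intro m _ c
        simp only [barWeight, shift]
        push_cast
        ring_nf
    · rw [ssytSum_eq_zero (c := (n, 0))
        (YoungDiagram.mem_iff_lt_rowLen.2 (Nat.pos_of_ne_zero h))
        fun m hm => by rw [barWeight, if_neg (by simp only; omega)]]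
      ring

/-- The numerator of an odd orthogonal character, with the factors `s_i - s̄_i` taken out of the
rows. The letter `0` contributes a vertical strip. -/
theorem alternant_facHom_add (x : ℕ → K) (n : ℕ) (A : ℤ → K) (μ : YoungDiagram)
    (hμ : μ.rowLen n = 0) :
    alternant n (fun i => delay fun m =>
        facHom A (x i) (m + 1) + (1 - A (m + 2)) * facHom A (x i) m) μ =
      ∑ ν ∈ vstrips μ, (∏ c ∈ μ.cells \ ν.cells, (1 - A ((n : ℤ) + 1 + c.2 - c.1))) *
        alternant n (fun i m => facHom A (x i) m) ν := by
  rw [alternant_eq_sum_vstrips (g := fun i m => facHom A (x i) m) (v := fun r => 1 - A (r + 1))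
    (by simp [facHom]) (fun i _ m => by simp only [delay_succ]; push_cast; ring_nf) hμ]
  refine Finset.sum_congr rfl fun ν _ => ?_
  congr 1
  refine Finset.prod_congr rfl fun c hc => ?_
  have := fst_lt_of_mem hμ ((YoungDiagram.mem_cells _).1 (Finset.mem_sdiff.1 hc).1)
  congr 2
  omega

theorem sub_mul_facHom_add {A : ℤ → K} {y s : K} (hy : y ≠ 0) (hs : s ^ 2 = y) (m : ℕ) :
    (s - s⁻¹) * (facHom A y (m + 1) + (1 - A (m + 2)) * facHom A y m) =
      s * facPowInt A y (m + 1) - s⁻¹ * facPowInt A y⁻¹ (m + 1) := by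
  have h := sub_mul_facHom A y m
  have hs0 : s ≠ 0 := fun h0 => hy (by rw [← hs, h0]; simp)
  have h1 : s⁻¹ * (y - y⁻¹) = (s - s⁻¹) * (1 + y⁻¹) := by
    rw [← hs]
    field_simp
    ring
  rw [facHom]
  linear_combination s⁻¹ * h - facHom A y m * h1

end Recurrences

/-! ### Coding the alphabets -/

section Codes

variable {K : Type*} [Field K] {n : ℕ} {μ : YoungDiagram}

/-- The variables `x_1, …, x_n`, followed by zeros. -/
def extendVars (x : Fin n → K) (k : ℕ) : K := if h : k < n then x ⟨k, h⟩ else 0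

@[simp]
theorem extendVars_val (x : Fin n → K) (k : Fin n) : extendVars x k = x k := by
  simp [extendVars]

/-- The position of a letter in the alphabet `1 < 1̄ < 2 < 2̄ < ⋯`, counted from `0`. -/
def letterCode (z : Letter n) : ℕ := 2 * (z.idx : ℕ) + if z.isBar then 1 else 0

theorem letterCode_div (z : Letter n) : letterCode z / 2 = z.idx := by
  unfold letterCode
  split_ifs <;> omega

theorem letterCode_mod (z : Letter n) : letterCode z % 2 = if z.isBar then 1 else 0 := by
  unfold letterCode
  split_ifs <;> omega

theorem letterCode_strictMono : StrictMono (letterCode (n := n)) := by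
  intro z z' h
  rcases (Prod.Lex.lt_iff).1 h with h | ⟨h1, h2⟩
  · have h' : (z.idx : ℕ) < z'.idx := h
    unfold letterCode
    split_ifs <;> omega
  · have h1' : z.idx = z'.idx := h1
    obtain ⟨h3, h4⟩ : z.isBar = false ∧ z'.isBar = true := Bool.lt_iff.1 h2
    simp [letterCode, h1', h3, h4]

theorem letterCode_lt (z : Letter n) : letterCode z < 2 * n := by
  have := z.idx.2
  unfold letterCode
  split_ifs <;> omega

theorem lt_two_mul_iff (m : ℕ) : m < 2 * n ↔ ∃ z : Letter n, letterCode z = m := by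
  constructor
  · intro h
    refine ⟨toLex (⟨m / 2, by omega⟩, decide (m % 2 = 1)), ?_⟩
    simp only [letterCode, Letter.idx, Letter.isBar, ofLex_toLex, decide_eq_true_eq]
    split_ifs <;> omega
  · rintro ⟨z, rfl⟩
    exact letterCode_lt z

/-- The position of a letter in the alphabet `1 < 1̄ < 2 < 2̄ < ⋯ < n < n̄ < 0`, counted from `0`. -/
def oddLetterCode : OddLetter n → ℕ := WithTop.recTopCoe (2 * n) letterCode

@[simp]
theorem oddLetterCode_top : oddLetterCode (⊤ : OddLetter n) = 2 * n := rfl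

@[simp]
theorem oddLetterCode_coe (z : Letter n) : oddLetterCode (z : OddLetter n) = letterCode z := rfl

theorem oddLetterCode_strictMono : StrictMono (oddLetterCode (n := n)) := by
  intro z z' h
  induction z using WithTop.recTopCoe with
  | top => exact absurd h not_top_lt
  | coe z =>
    induction z' using WithTop.recTopCoe with
    | top => exact letterCode_lt z
    | coe z' => exact letterCode_strictMono (WithTop.coe_lt_coe.1 h)

theorem lt_two_mul_add_one_iff (m : ℕ) : m < 2 * n + 1 ↔ ∃ z : OddLetter n, oddLetterCode z = m := by
  constructor
  · intro h
    rcases (Nat.lt_succ_iff.1 h).lt_or_eq with h | rfl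
    · obtain ⟨z, hz⟩ := (lt_two_mul_iff m).1 h
      exact ⟨z, hz⟩
    · exact ⟨⊤, rfl⟩
  · rintro ⟨z, rfl⟩
    induction z using WithTop.recTopCoe with
    | top => exact Nat.lt_succ_self _
    | coe z => exact (letterCode_lt z).trans (Nat.lt_succ_self _)

theorem oddLetterCode_eq_iff (z : OddLetter n) : oddLetterCode z = 2 * n ↔ z = ⊤ :=
  ⟨fun h => oddLetterCode_strictMono.injective h, fun h => h ▸ rfl⟩

theorem T3_comp_iff {A : Type} [LinearOrder A] {code : A → ℕ} (hcode : StrictMono code)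
    {T : Filling μ A} : T3 (fun c => code (T c)) ↔ T3 T := by
  simp only [T3, hcode.injective.ne_iff]

/-! ### Character sums as sums over coded tableaux -/

theorem fst_le_of_T2_T3 {T : Filling μ (Fin n)} (h2 : T2 T) (h3 : T3 T) (c : μ.cells) :
    c.1.1 ≤ T c := by
  obtain ⟨⟨i, j⟩, hc⟩ := c
  induction i with
  | zero => exact Nat.zero_le _
  | succ i ih =>
    have hc' : (i, j) ∈ μ.cells :=
      μ.isLowerSet (show (i, j) ≤ (i + 1, j) from ⟨Nat.le_succ i, le_rfl⟩) hc
    have hle := h2 ⟨_, hc'⟩ ⟨_, hc⟩ rfl (by simp [row])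
    have hne := h3 ⟨_, hc'⟩ ⟨_, hc⟩ rfl (by simp [row])
    have hlt : (T ⟨_, hc'⟩ : ℕ) < T ⟨_, hc⟩ := Fin.lt_def.1 (lt_of_le_of_ne hle hne)
    exact (Nat.succ_le_succ (ih hc')).trans hlt

theorem sum_glTableaux (x : Fin n → K) (a : ℕ+ → K) :
    ∑ T ∈ glTableaux μ n, ∏ c, glWeight x a c (T c) =
      ssytSum (glCodeWeight (extendVars x) (ext a)) n μ := by
  classical
  refine sum_eq_sum_monoFillings (code := fun k : Fin n => (k : ℕ)) Fin.val_strictMono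
    (fun m => ⟨fun h => ⟨⟨m, h⟩, rfl⟩, by rintro ⟨z, rfl⟩; exact z.2⟩) (fun T => T3 T)
    (by simp [glTableaux, and_assoc]) _ _ ?_
  intro T hT
  simp only [T3_comp_iff Fin.val_strictMono]
  refine ite_congr rfl (fun h3 => ?_) fun _ => rfl
  refine Finset.prod_congr rfl fun c _ => ?_
  rw [glCodeWeight, if_pos (fst_le_of_T2_T3 hT.2 h3 c), extendVars_val, glWeight]
  congr 2
  simp only [row, col]
  push_cast
  ring

theorem prod_barWeight (x : Fin n → K) (A : ℤ → K) (T : Filling μ (Letter n)) [Decidable (T4 T)] :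
    ∏ c, barWeight (extendVars x) A n (letterCode (T c)) c.1 =
      if T4 T then ∏ c : μ.cells, (if (T c).isBar then
        (x (T c).idx)⁻¹ + A (2 * (((T c).idx : ℤ) + 1) + 1 - n + col c - row c)
      else x (T c).idx + A (2 * (((T c).idx : ℤ) + 1) - n + col c - row c)) else 0 := by
  split_ifs with h
  · refine Finset.prod_congr rfl fun c _ => ?_
    have hc := h c
    rw [row] at hc
    rw [barWeight, letterCode_div, letterCode_mod, if_pos (by omega), extendVars_val]
    have e : ((col c : ℤ) - row c) = (c.1.2 : ℤ) - c.1.1 := by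
      simp only [row, col]
      push_cast
      ring
    cases (T c).isBar
    · simp only [Bool.false_eq_true, if_false, if_true, add_sub_assoc, e]
    · simp only [if_true, one_ne_zero, if_false, add_sub_assoc, e]
  · obtain ⟨c, hc⟩ := not_forall.1 h
    rw [row] at hc
    refine Finset.prod_eq_zero (Finset.mem_univ c) ?_
    rw [barWeight, letterCode_div, if_neg (by omega)]

theorem sum_spTableaux (x : Fin n → K) (a : ℕ+ → K) :
    ∑ T ∈ spTableaux μ n, ∏ c, spWeight x a c (T c) =
      ssytSum (barWeight (extendVars x) (shift (ext a)) n) (2 * n) μ := by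
  classical
  refine sum_eq_sum_monoFillings letterCode_strictMono lt_two_mul_iff (fun T => T3 T ∧ T4 T)
    (by simp [spTableaux, and_assoc]) _ _ ?_
  intro T _
  simp only [T3_comp_iff letterCode_strictMono, prod_barWeight, ite_and]
  refine ite_congr rfl (fun _ => ite_congr rfl (fun _ => ?_) fun _ => rfl) fun _ => rfl
  refine Finset.prod_congr rfl fun c _ => ?_
  rw [spWeight]
  simp only [shift]
  congr 3 <;> ring

/-- At most one greatest letter `N` appears in any row, and no other letter appears twice in a
column. -/
def IsOddSSYT (N : ℕ) (T : Filling μ ℕ) : Prop :=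
  (∀ c d : μ.cells, col c = col d → row c ≠ row d → T c ≠ N → T c ≠ T d) ∧
    ∀ c d : μ.cells, row c = row d → T c = N → T d = N → c = d

theorem isOddSSYT_extendBy {ν : YoungDiagram} {N : ℕ} (hνμ : ν ≤ μ) {T : Filling ν ℕ}
    (hT : T ∈ monoFillings ν N) : IsOddSSYT N (extendBy μ N T) ↔ ν ∈ vstrips μ ∧ T3 T := by
  have hlt := (mem_monoFillings.1 hT).1
  have hsub : ν.cells ⊆ μ.cells := YoungDiagram.cells_subset_iff.2 hνμ
  have hN : ∀ c : μ.cells, extendBy μ N T c = N ↔ c.1 ∉ ν.cells := by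
    intro c
    by_cases h : c.1 ∈ ν.cells
    · rw [extendBy_of_mem h]
      exact ⟨fun h' => absurd h' (hlt _).ne, fun h' => absurd h h'⟩
    · rw [extendBy_of_notMem h]
      exact ⟨fun _ => h, fun _ => rfl⟩
  rw [mem_vstrips]
  constructor
  · rintro ⟨h3, h5⟩
    refine ⟨⟨hνμ, fun i c hc => ?_⟩, fun c d hcol hrow heq => ?_⟩
    · by_contra hic
      have hle : (i, c) ≤ (i, c + 1) := ⟨le_rfl, Nat.le_succ c⟩
      have hsucc : (i, c + 1) ∉ ν.cells := fun h' => hic (ν.isLowerSet hle h')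
      have := h5 ⟨(i, c), μ.isLowerSet hle hc⟩ ⟨(i, c + 1), hc⟩ rfl ((hN _).2 hic) ((hN _).2 hsucc)
      simp at this
    · refine h3 ⟨c.1, hsub c.2⟩ ⟨d.1, hsub d.2⟩ hcol hrow ?_ ?_
      · rw [Ne, hN]
        exact fun h => h c.2
      · rw [extendBy_of_mem (c := ⟨c.1, hsub c.2⟩) c.2, extendBy_of_mem (c := ⟨d.1, hsub d.2⟩) d.2]
        exact heq
  · rintro ⟨⟨-, hstrip⟩, h3⟩
    have key : ∀ c d : μ.cells, row c = row d → col c < col d → c.1 ∈ ν.cells := by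
      rintro ⟨⟨i, j⟩, hc⟩ ⟨⟨i', j'⟩, hd⟩ hrow hcol
      simp only [col, row] at hcol hrow
      obtain rfl : i = i' := by omega
      exact hstrip i j (μ.isLowerSet (show (i, j + 1) ≤ (i, j') from ⟨le_rfl, by simp; omega⟩) hd)
    refine ⟨fun c d hcol hrow hc heq => ?_, fun c d hrow hc hd => ?_⟩
    · have hd := heq ▸ hc
      rw [Ne, hN, not_not] at hc hd
      rw [extendBy_of_mem hc, extendBy_of_mem hd] at heq
      exact h3 ⟨c.1, hc⟩ ⟨d.1, hd⟩ hcol hrow heq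
    · rw [hN] at hc hd
      rcases lt_trichotomy (col c) (col d) with h | h | h
      · exact absurd (key c d hrow h) hc
      · simp only [row, col, Nat.add_right_cancel_iff] at hrow h
        exact Subtype.ext (Prod.ext hrow h)
      · exact absurd (key d c hrow.symm h) hd

theorem sum_ooTableaux (x : Fin n → K) (a : ℕ+ → K) :
    ∑ T ∈ ooTableaux μ n, ∏ c, ooWeight x a c (T c) =
      ∑ ν ∈ vstrips μ, (∏ c ∈ μ.cells \ ν.cells, (1 - ext a ((n : ℤ) + 1 + c.2 - c.1))) *
        ssytSum (barWeight (extendVars x) (ext a) n) (2 * n) ν := by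
  classical
  set w : ℕ → ℕ × ℕ → K := fun m c => if m = 2 * n then 1 - ext a ((n : ℤ) + 1 + c.2 - c.1)
    else barWeight (extendVars x) (ext a) n m c with hw
  have hcode : ∑ T ∈ ooTableaux μ n, ∏ c, ooWeight x a c (T c) =
      ∑ T ∈ monoFillings μ (2 * n + 1),
        if IsOddSSYT (2 * n) T then ∏ c, w (T c) c.1 else 0 := by
    refine sum_eq_sum_monoFillings oddLetterCode_strictMono lt_two_mul_add_one_iff
      (fun T => (T3Odd T ∧ T5 T) ∧ T4Odd T) (fun T => by simp [ooTableaux]; tauto) _ _ ?_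
    intro T _
    have hiff : IsOddSSYT (2 * n) (fun c => oddLetterCode (T c)) ↔ T3Odd T ∧ T5 T := by
      simp only [IsOddSSYT, T3Odd, T5, oddLetterCode_eq_iff, ne_eq,
        oddLetterCode_strictMono.injective.eq_iff]
    by_cases h35 : T3Odd T ∧ T5 T
    swap
    · rw [if_neg fun h => h35 (hiff.1 h), if_neg fun h => h35 h.1]
    rw [if_pos (hiff.2 h35)]
    have e (c : μ.cells) : ((col c : ℤ) - row c) = (c.1.2 : ℤ) - c.1.1 := by
      simp only [row, col]
      push_cast
      ring
    by_cases h : T4Odd T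
    · rw [if_pos ⟨h35, h⟩]
      refine Finset.prod_congr rfl fun c _ => ?_
      have hc := h c
      induction hz : T c using WithTop.recTopCoe with
      | top =>
        simp only [hz, hw, oddLetterCode_top, if_true, ooWeight, WithTop.recTopCoe_top, add_sub_assoc, e]
      | coe z =>
        have hr := hc z hz
        rw [row] at hr
        simp only [hz, hw, oddLetterCode_coe, if_neg (letterCode_lt z).ne, ooWeight,
          WithTop.recTopCoe_coe, barWeight, letterCode_div, letterCode_mod,
          if_pos (show c.1.1 ≤ (z.idx : ℕ) by omega), extendVars_val]
        cases z.isBar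
        · simp only [Bool.false_eq_true, if_false, if_true, add_sub_assoc, e]
        · simp only [if_true, one_ne_zero, if_false, add_sub_assoc, e]
    · rw [if_neg fun h' => h h'.2]
      simp only [T4Odd, not_forall] at h
      obtain ⟨c, z, hz, hr⟩ := h
      rw [row] at hr
      refine Finset.prod_eq_zero (Finset.mem_univ c) ?_
      simp only [hz, hw, oddLetterCode_coe, if_neg (letterCode_lt z).ne, barWeight, letterCode_div,
          if_neg (show ¬ c.1.1 ≤ (z.idx : ℕ) by omega)]
  rw [hcode, sum_monoFillings_succ]
  have hsub : vstrips μ ⊆ subdiagrams μ := Finset.filter_subset _ _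
  rw [← Finset.sum_subset hsub]
  · refine Finset.sum_congr rfl fun ν hν => ?_
    have hνμ := (mem_vstrips.1 hν).1
    rw [ssytSum_congr (w' := w) (fun m hm c => by simp only [hw, if_neg hm.ne]), ssytSum,
      Finset.mul_sum]
    refine Finset.sum_congr rfl fun T hT => ?_
    simp only [isOddSSYT_extendBy hνμ hT, hν, true_and, prod_extendBy hνμ T w, mul_ite, mul_zero]
    simp only [hw, if_true]
  · intro ν hν hν'
    refine Finset.sum_eq_zero fun T hT => ?_
    rw [if_neg]
    rw [isOddSSYT_extendBy (mem_subdiagrams.1 hν) hT]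
    exact fun h => hν' h.1

end Codes

/-! ### Sums over even orthogonal tableaux -/

section EvenTableaux

variable {K : Type*} [Field K] {n : ℕ} {μ ν κ : YoungDiagram}

/-- The boxes of a filling that hold the letter `m`. -/
def letterBoxes (T : Filling μ ℕ) (m : ℕ) : Finset (ℕ × ℕ) :=
  {c ∈ μ.cells.attach | T c = m}.map (Function.Embedding.subtype _)

theorem mem_letterBoxes {T : Filling μ ℕ} {m : ℕ} {c : ℕ × ℕ} :
    c ∈ letterBoxes T m ↔ ∃ h : c ∈ μ.cells, T ⟨c, h⟩ = m := by
  simp [letterBoxes]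

theorem letterBoxes_extendBy_of_lt {N m : ℕ} (hνμ : ν ≤ μ) (T : Filling ν ℕ) (hm : m < N) :
    letterBoxes (extendBy μ N T) m = letterBoxes T m := by
  ext c
  rw [mem_letterBoxes, mem_letterBoxes]
  constructor
  · rintro ⟨h, hc⟩
    by_cases h' : c ∈ ν.cells
    · rw [extendBy_of_mem (c := ⟨c, h⟩) h'] at hc
      exact ⟨h', hc⟩
    · rw [extendBy_of_notMem (c := ⟨c, h⟩) h'] at hc
      omega
  · rintro ⟨h, hc⟩
    exact ⟨hνμ h, by rw [extendBy_of_mem (c := ⟨c, hνμ h⟩) h, hc]⟩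

theorem letterBoxes_extendBy_self {N : ℕ} {T : Filling ν ℕ} (hT : T ∈ monoFillings ν N) :
    letterBoxes (extendBy μ N T) N = μ.cells \ ν.cells := by
  ext c
  rw [mem_letterBoxes, Finset.mem_sdiff]
  constructor
  · rintro ⟨h, hc⟩
    refine ⟨h, fun h' => ?_⟩
    rw [extendBy_of_mem (c := ⟨c, h⟩) h'] at hc
    exact ((mem_monoFillings.1 hT).1 _).ne hc
  · rintro ⟨h, hc⟩
    exact ⟨h, extendBy_of_notMem (c := ⟨c, h⟩) hc⟩

/-- The condition on the boxes `U` and `V` with letters `k + 1` and its barred version: if a box of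
`U` lies in the row with index `k`, then every box of `V` in this row has a box of `U` above it. -/
def Covers (k : ℕ) (U V : Finset (ℕ × ℕ)) : Prop :=
  (∃ b ∈ U, b.1 = k) → ∀ c ∈ V, c.1 = k → ∃ d ∈ U, d.1 + 1 = k ∧ d.2 = c.2

/-- The condition that in the first column the row with index `k` has a box of `V` below a box of
`U`. -/
def Doubles (k : ℕ) (U V : Finset (ℕ × ℕ)) : Prop :=
  ∃ c ∈ U, ∃ d ∈ V, c.2 = 0 ∧ d.2 = 0 ∧ c.1 + 1 = k ∧ d.1 = k

open Classical in
/-- The contribution of the letters `k + 1` and its barred version, placed in the boxes `U` and `V`,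
to the factor `2 ^ ζ(T)`; it is zero if the covering condition fails. -/
noncomputable def pairFactor (K : Type*) [Field K] (k : ℕ) (U V : Finset (ℕ × ℕ)) : K :=
  if Covers k U V then if Doubles k U V then 2 else 1 else 0

open Classical in
/-- The weighted sum over the even orthogonal tableaux of shape `μ`, with letters coded by
`0, 1, …, 2 n - 1`. -/
noncomputable def evenSum (w : ℕ → ℕ × ℕ → K) (n : ℕ) (μ : YoungDiagram) : K :=
  ∑ T ∈ monoFillings μ (2 * n), if T3 T then (∏ c, w (T c) c.1) *
    ∏ k ∈ Finset.range n, pairFactor K k (letterBoxes T (2 * k)) (letterBoxes T (2 * k + 1)) else 0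

theorem evenSum_succ (w : ℕ → ℕ × ℕ → K) (n : ℕ) (μ : YoungDiagram) :
    evenSum w (n + 1) μ = ∑ ν ∈ hstrips μ, ∑ κ ∈ hstrips ν,
      (∏ c ∈ μ.cells \ ν.cells, w (2 * n + 1) c) * (∏ c ∈ ν.cells \ κ.cells, w (2 * n) c) *
        pairFactor K n (ν.cells \ κ.cells) (μ.cells \ ν.cells) * evenSum w n κ := by
  classical
  have hsub (μ : YoungDiagram) : hstrips μ ⊆ subdiagrams μ := Finset.filter_subset _ _
  have hT3 : ∀ ν ∈ subdiagrams μ, ∀ κ ∈ subdiagrams ν, ∀ T ∈ monoFillings κ (2 * n),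
      (T3 (extendBy μ (2 * n + 1) (extendBy ν (2 * n) T)) ↔
        ν ∈ hstrips μ ∧ κ ∈ hstrips ν ∧ T3 T) := by
    intro ν hν κ hκ T hT
    rw [T3_extendBy (mem_subdiagrams.1 hν) (extendBy_mem_monoFillings hT),
      T3_extendBy (mem_subdiagrams.1 hκ) hT]
  rw [evenSum, show 2 * (n + 1) = 2 * n + 1 + 1 by ring, sum_monoFillings_succ,
    ← Finset.sum_subset (hsub μ)]
  · refine Finset.sum_congr rfl fun ν hν => ?_
    rw [sum_monoFillings_succ, ← Finset.sum_subset (hsub ν)]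
    · refine Finset.sum_congr rfl fun κ hκ => ?_
      have hν' := (mem_hstrips.1 hν).1
      have hκ' := (mem_hstrips.1 hκ).1
      rw [evenSum, Finset.mul_sum]
      refine Finset.sum_congr rfl fun T hT => ?_
      rw [prod_extendBy hν', prod_extendBy hκ', Finset.prod_range_succ,
        letterBoxes_extendBy_self (extendBy_mem_monoFillings hT),
        letterBoxes_extendBy_of_lt hν' _ (Nat.lt_succ_self _), letterBoxes_extendBy_self hT]
      have hprod : ∏ k ∈ Finset.range n, pairFactor K k
          (letterBoxes (extendBy μ (2 * n + 1) (extendBy ν (2 * n) T)) (2 * k))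
          (letterBoxes (extendBy μ (2 * n + 1) (extendBy ν (2 * n) T)) (2 * k + 1)) =
          ∏ k ∈ Finset.range n, pairFactor K k (letterBoxes T (2 * k))
            (letterBoxes T (2 * k + 1)) := by
        refine Finset.prod_congr rfl fun k hk => ?_
        rw [Finset.mem_range] at hk
        rw [letterBoxes_extendBy_of_lt hν' _ (by omega), letterBoxes_extendBy_of_lt hκ' _ (by omega),
          letterBoxes_extendBy_of_lt hν' _ (by omega), letterBoxes_extendBy_of_lt hκ' _ (by omega)]
      rw [hprod]
      simp only [hT3 ν (hsub μ hν) κ (hsub ν hκ) T hT, hν, hκ, true_and]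
      split_ifs
      · ring
      · ring
    · intro κ hκ hκ'
      refine Finset.sum_eq_zero fun T hT => if_neg ?_
      rw [hT3 ν (hsub μ hν) κ hκ T hT]
      exact fun h => hκ' h.2.1
  · intro ν hν hν'
    rw [sum_monoFillings_succ]
    refine Finset.sum_eq_zero fun κ hκ => Finset.sum_eq_zero fun T hT => if_neg ?_
    rw [hT3 ν hν κ hκ T hT]
    exact fun h => hν' h.1

theorem evenSum_eq_zero {w : ℕ → ℕ × ℕ → K} {c : ℕ × ℕ} (hc : c ∈ μ)
    (h : ∀ m < 2 * n, w m c = 0) : evenSum w n μ = 0 := by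
  refine Finset.sum_eq_zero fun T hT => ?_
  rw [Finset.prod_eq_zero (Finset.mem_univ ⟨c, hc⟩) (h _ ((mem_monoFillings.1 hT).1 _)), zero_mul,
    ite_self]

theorem evenSum_congr {w w' : ℕ → ℕ × ℕ → K} (h : ∀ m c, w m c = w' m c) (μ : YoungDiagram) :
    evenSum w n μ = evenSum w' n μ := by
  rw [show w = w' from funext fun m => funext (h m)]

theorem evenSum_bot (w : ℕ → ℕ × ℕ → K) (n : ℕ) : evenSum w n ⊥ = 1 := by
  have h3 (T : Filling ⊥ ℕ) : T3 T := fun c => isEmptyElim c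
  have hbox (T : Filling ⊥ ℕ) (m : ℕ) : letterBoxes T m = ∅ :=
    Finset.eq_empty_of_forall_notMem fun c hc =>
      YoungDiagram.notMem_bot c (mem_letterBoxes.1 hc).1
  rw [evenSum, monoFillings_bot, Fintype.sum_unique, if_pos (h3 _), Finset.univ_eq_empty,
    Finset.prod_empty, one_mul]
  refine Finset.prod_eq_one fun k _ => ?_
  simp [hbox, pairFactor, Covers, Doubles]

/-! ### Regrouping pairs of strips by the last row -/

theorem sum_piFinset_snoc (I : Fin (n + 1) → Finset ℕ) (F : (Fin (n + 1) → ℕ) → K) :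
    ∑ f ∈ Fintype.piFinset I, F f =
      ∑ f ∈ Fintype.piFinset fun i : Fin n => I i.castSucc, ∑ q ∈ I (Fin.last n),
        F (Fin.snoc (α := fun _ => ℕ) f q) := by
  rw [← Finset.sum_product']
  refine Finset.sum_bij' (fun f _ => (Fin.init f, f (Fin.last n)))
    (fun p _ => Fin.snoc (α := fun _ => ℕ) p.1 p.2) ?_ ?_ ?_ ?_ ?_
  · intro f hf
    rw [Fintype.mem_piFinset] at hf
    exact Finset.mem_product.2 ⟨Fintype.mem_piFinset.2 fun i => hf i.castSucc, hf _⟩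
  · intro p hp
    rw [Finset.mem_product, Fintype.mem_piFinset] at hp
    rw [Fintype.mem_piFinset]
    intro i
    induction i using Fin.lastCases with
    | last => simpa using hp.2
    | cast i => simpa using hp.1 i
  · intro f _
    simp
  · intro p _
    simp
  · intro f _
    simp

/-- A bound for the last row of `ν`, where `κ` is obtained from `ν` by removing a horizontal strip
that includes the whole row with index `n`: the preceding row of `κ`, if there is one. -/
def lastBound (n b : ℕ) (κ : YoungDiagram) : ℕ := if n = 0 then b else κ.rowLen (n - 1)

open Classical in
/-- In a sum over pairs of strips `μ / ν` and `ν / κ` where `κ` has at most `n` rows, the length `q`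
of the row of `ν` with index `n` ranges over an interval once `κ` and the other rows of `ν` are
fixed. Only the sums over these intervals matter. -/
theorem sum_hstrips_hstrips_congr (hμ : μ.rowLen (n + 1) = 0)
    (L : (Fin n → ℕ) → YoungDiagram → K) (R R' : ℕ → YoungDiagram → K)
    (h : ∀ κ, ∑ q ∈ Finset.range (min (μ.rowLen n) (lastBound n (μ.rowLen n) κ) + 1), R q κ =
      ∑ q ∈ Finset.range (min (μ.rowLen n) (lastBound n (μ.rowLen n) κ) + 1), R' q κ) :
    (∑ ν ∈ hstrips μ, ∑ κ ∈ hstrips ν, if κ.rowLen n = 0 then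
        L (fun i => ν.rowLen i) κ * R (ν.rowLen n) κ else 0) =
      ∑ ν ∈ hstrips μ, ∑ κ ∈ hstrips ν, if κ.rowLen n = 0 then
        L (fun i => ν.rowLen i) κ * R' (ν.rowLen n) κ else 0 := by
  -- the conditions on `κ` that do not involve the last row of `ν`
  let Q : (Fin n → ℕ) → YoungDiagram → Prop := fun f κ => κ.rowLen n = 0 ∧
    ∀ i : Fin n, κ.rowLen i ≤ f i ∧ ∀ h : (i : ℕ) + 1 < n, f ⟨i + 1, h⟩ ≤ κ.rowLen i
  have key : ∀ R : ℕ → YoungDiagram → K,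
      (∑ ν ∈ hstrips μ, ∑ κ ∈ hstrips ν, if κ.rowLen n = 0 then
        L (fun i => ν.rowLen i) κ * R (ν.rowLen n) κ else 0) =
      ∑ f ∈ Fintype.piFinset fun i : Fin n => Finset.Icc (μ.rowLen (i + 1)) (μ.rowLen i),
        ∑ κ ∈ subdiagrams μ, if Q f κ then L f κ *
          ∑ q ∈ Finset.range (min (μ.rowLen n) (lastBound n (μ.rowLen n) κ) + 1), R q κ else 0 := by
    intro R
    rw [sum_hstrips hμ, sum_piFinset_snoc]
    simp only [Fin.val_castSucc, Fin.val_last]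
    refine Finset.sum_congr rfl fun f hf => ?_
    have hmem : ∀ q ∈ Finset.Icc (μ.rowLen (n + 1)) (μ.rowLen n),
        ∀ j : Fin (n + 1), Fin.snoc (α := fun _ => ℕ) f q j ∈
          Finset.Icc (μ.rowLen (j + 1)) (μ.rowLen j) := by
      intro q hq j
      rw [Fintype.mem_piFinset] at hf
      induction j using Fin.lastCases with
      | last => simpa using hq
      | cast i => simpa using hf i
    have hinner : ∀ q ∈ Finset.Icc (μ.rowLen (n + 1)) (μ.rowLen n),
        (∑ κ ∈ hstrips (ofRows (Fin.snoc (α := fun _ => ℕ) f q)), if κ.rowLen n = 0 then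
          L (fun i => (ofRows (Fin.snoc (α := fun _ => ℕ) f q)).rowLen i) κ *
            R ((ofRows (Fin.snoc (α := fun _ => ℕ) f q)).rowLen n) κ else 0) =
        ∑ κ ∈ subdiagrams μ, if Q f κ ∧ q ≤ lastBound n (μ.rowLen n) κ then L f κ * R q κ
          else 0 := by
      intro q hq
      have hanti := antitone_of_interlacing (hmem q hq)
      set ν := ofRows (Fin.snoc (α := fun _ => ℕ) f q) with hν
      have hlast : ν.rowLen n = q := by
        have := rowLen_ofRows hanti (Fin.last n)
        simpa using this
      have hcast : ∀ i : Fin n, ν.rowLen i = f i := fun i => by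
        have := rowLen_ofRows hanti i.castSucc
        simpa using this
      have hsucc : ν.rowLen (n + 1) = 0 := rowLen_ofRows_of_le hanti le_rfl
      have hνμ : ν ≤ μ := by
        refine le_iff_rowLen.2 fun i => ?_
        rcases lt_or_ge i (n + 1) with hi | hi
        · exact (rowLen_ofRows hanti ⟨i, hi⟩).le.trans (Finset.mem_Icc.1 (hmem q hq ⟨i, hi⟩)).2
        · rw [rowLen_eq_zero_of_le hsucc hi]
          exact Nat.zero_le _
      rw [hlast, show (fun i : Fin n => ν.rowLen i) = f from funext hcast, ← Finset.sum_filter,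
        ← Finset.sum_filter]
      refine Finset.sum_congr (Finset.ext fun κ => ?_) fun _ _ => rfl
      rw [Finset.mem_filter, Finset.mem_filter, mem_hstrips_iff_rowLen, mem_subdiagrams]
      constructor
      · rintro ⟨hs, h0⟩
        refine ⟨(le_iff_rowLen.2 fun i => (hs i).2).trans hνμ, ⟨h0, fun i => ⟨?_, fun hi => ?_⟩⟩, ?_⟩
        · rw [← hcast]
          exact (hs i).2
        · rw [← hcast]
          exact (hs i).1
        · rw [lastBound]
          split_ifs with hn
          · exact (Finset.mem_Icc.1 hq).2
          · have := (hs (n - 1)).1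
            rwa [Nat.sub_add_cancel (Nat.pos_of_ne_zero hn), hlast] at this
      · rintro ⟨hκμ, ⟨h0, hQ⟩, hb⟩
        refine ⟨fun i => ?_, h0⟩
        rcases lt_or_ge i n with hi | hi
        · have h1 := hQ ⟨i, hi⟩
          have h2 := hcast ⟨i, hi⟩
          simp only at h1 h2
          refine ⟨?_, by omega⟩
          rcases lt_or_ge (i + 1) n with hi' | hi'
          · have h3 := hcast ⟨i + 1, hi'⟩
            simp only at h3
            have h4 := h1.2 hi'
            omega
          · obtain rfl : n = i + 1 := by omega
            rw [lastBound, if_neg (by omega)] at hb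
            rw [hlast]
            exact hb
        · rw [rowLen_eq_zero_of_le h0 hi, rowLen_eq_zero_of_le hsucc (Nat.succ_le_succ hi)]
          simp
    rw [Finset.sum_congr rfl hinner, Finset.sum_comm]
    refine Finset.sum_congr rfl fun κ _ => ?_
    by_cases hQ : Q f κ
    · simp only [hQ, true_and, if_true]
      rw [← Finset.sum_filter, Finset.mul_sum]
      refine Finset.sum_congr (Finset.ext fun q => ?_) fun _ _ => rfl
      simp only [Finset.mem_filter, Finset.mem_Icc, Finset.mem_range, hμ]
      omega
    · simp [hQ]
  rw [key R, key R']
  simp only [h]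

end EvenTableaux

/-! ### The even orthogonal alternant -/

section EvenAlternant

variable {K : Type*} [Field K]

/-- The sequence `(y|A)^m + (ȳ|A)^m` with its value at `m = 0` halved, so that it starts with `1`. -/
def evenSeq (A : ℤ → K) (y : K) : ℕ → K :=
  delay fun m => facPowInt A y (m + 1) + facPowInt A y⁻¹ (m + 1)

/-- The weights `x_k + a_{2k-1-n+j-i+δ_{ik}}` of the letter `k` and `x̄_k + a_{2k-n+j-i}` of the
letter `k̄` in the box `(i, j)`, for the letters `1, 1̄, 2, 2̄, …` coded by `0, 1, 2, 3, …`. They are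
set to zero below row `k`. -/
def evenWeight (x : ℕ → K) (A : ℤ → K) (n m : ℕ) (c : ℕ × ℕ) : K :=
  if c.1 ≤ m / 2 then
    if m % 2 = 0 then
      x (m / 2) + A (2 * ((m / 2 : ℕ) + 1) - 1 - n + c.2 - c.1 + if c.1 = m / 2 then 1 else 0)
    else (x (m / 2))⁻¹ + A (2 * ((m / 2 : ℕ) + 1) - n + c.2 - c.1)
  else 0

theorem prod_Ico_facPowInt (A : ℤ → K) (y : K) (q : ℕ) :
    ∏ c ∈ Finset.Ico 0 q, (y + A (c + 1)) = facPowInt A y q := by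
  rw [facPowInt, Finset.range_eq_Ico]

/-- The multiplier in the recurrence that peels off the letter `n̄`. The factor `2` at `r = 1`, a
value that occurs only in the last row, comes from the normalization of `evenSeq`. -/
def evenBarMult (A : ℤ → K) (z : K) (r : ℕ) : K := if r = 1 then 2 * (z⁻¹ + A 1) else z⁻¹ + A r

/-- The multiplier in the recurrence that peels off the letter `n`. In the last row it differs from
the weight of this letter, where the parameter is moved by `δ_{ik}`. -/
def evenPlainMult (A : ℤ → K) (z : K) (r : ℕ) : K := if r = 1 then z - z⁻¹ else z + A (r - 1)

theorem prod_Ico_evenPlainMult (A : ℤ → K) (z : K) (q : ℕ) :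
    ∏ c ∈ Finset.Ico 0 (q + 1), evenPlainMult A z (c + 1) = (z - z⁻¹) * facPowInt A z q := by
  rw [← Finset.range_eq_Ico, Finset.prod_range_succ', mul_comm]
  simp [evenPlainMult, facPowInt]

/-- The total contribution of the last row to the expansion of the alternant, where `q` is the number
of its boxes that survive the first step. -/
theorem sum_evenMult (A : ℤ → K) (z : K) {b d : ℕ} (hb : 0 < b) (hd : d ≤ b) :
    ∑ q ∈ Finset.range (d + 1), (∏ c ∈ Finset.Ico q b, evenBarMult A z (c + 1)) *
        ∏ c ∈ Finset.Ico 0 q, evenPlainMult A z (c + 1) =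
      (facPowInt A z d + facPowInt A z⁻¹ d) * ∏ c ∈ Finset.Ico d b, (z⁻¹ + A (c + 1)) := by
  induction d with
  | zero =>
    rw [Finset.sum_range_one, Finset.Ico_self, Finset.prod_empty,
      Finset.prod_eq_prod_Ico_succ_bot hb, Finset.prod_eq_prod_Ico_succ_bot hb,
      Finset.prod_congr (g := fun c : ℕ => z⁻¹ + A (c + 1)) rfl fun c hc => by
        rw [evenBarMult, if_neg (by simp only [Finset.mem_Ico] at hc; omega)]
        push_cast
        rfl]
    simp [evenBarMult]
    ring
  | succ d ih =>
    rw [Finset.sum_range_succ, ih (by omega), prod_Ico_evenPlainMult,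
      Finset.prod_eq_prod_Ico_succ_bot (show d < b by omega), facPowInt_succ, facPowInt_succ,
      Finset.prod_congr (s₂ := Finset.Ico (d + 1) b) (f := fun c => evenBarMult A z (c + 1))
        (g := fun c : ℕ => z⁻¹ + A (c + 1)) rfl fun c hc => by
        rw [evenBarMult, if_neg (by simp only [Finset.mem_Ico] at hc; omega)]
        push_cast
        rfl]
    ring

/-- The total contribution of the last row to the sum over tableaux. These are the possible contents of the last row, which consists of `q` letters `n` followed by `b - q`
letters `n̄`, when the boxes above it with letters below `n` are the first `p` ones. The covering
condition leaves the values `q = 0`, `q = b` and `q = p`. -/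
theorem sum_lastRow (A : ℤ → K) (y z : K) {b p : ℕ} (hb : 0 < b) :
    ∑ q ∈ Finset.range (min b p + 1), (∏ c ∈ Finset.Ico q b, (y + A (c + 1))) *
        (∏ c ∈ Finset.Ico 0 q, (z + A (c + 1))) *
        (if q = 0 ∨ b ≤ q ∨ p ≤ q then if p = 0 ∧ q = 0 ∧ 0 < b then 2 else 1 else 0) =
      (facPowInt A z (min b p) + facPowInt A y (min b p)) *
        ∏ c ∈ Finset.Ico (min b p) b, (y + A (c + 1)) := by
  rcases Nat.eq_zero_or_pos p with rfl | hp
  · simp [hb]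
    ring
  · have hd : 0 < min b p := lt_min hb hp
    have hprod : ∏ c ∈ Finset.Ico 0 b, (y + A ((c : ℤ) + 1)) =
        facPowInt A y (min b p) * ∏ c ∈ Finset.Ico (min b p) b, (y + A ((c : ℤ) + 1)) := by
      rw [← prod_Ico_facPowInt, Finset.prod_Ico_consecutive _ (Nat.zero_le _) (min_le_left b p)]
    rw [Finset.sum_eq_add 0 (min b p) hd.ne]
    · rw [if_pos (Or.inl rfl), if_neg (by omega), if_pos (by omega), if_neg (by omega), hprod,
        prod_Ico_facPowInt A z (min b p)]
      simp
      ring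
    · intro q hq hne
      rw [Finset.mem_range] at hq
      rw [if_neg (by omega), mul_zero]
    · intro h
      exact absurd (Finset.mem_range.2 (Nat.succ_pos _)) h
    · intro h
      exact absurd (Finset.mem_range.2 (Nat.lt_succ_self _)) h

/-- The conditions on the letters `n` and `n̄` (here with index `n`) in terms of row lengths: only
the last row of `ν` and the last rows of `μ` and `κ` matter. -/
theorem pairFactor_eq {n : ℕ} {μ ν κ : YoungDiagram} (hν : ν ∈ hstrips μ) (hκ : κ ∈ hstrips ν)
    (h0 : κ.rowLen n = 0) :
    pairFactor K n (ν.cells \ κ.cells) (μ.cells \ ν.cells) =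
      if ν.rowLen n = 0 ∨ μ.rowLen n ≤ ν.rowLen n ∨ lastBound n (μ.rowLen n) κ ≤ ν.rowLen n then
        if lastBound n (μ.rowLen n) κ = 0 ∧ ν.rowLen n = 0 ∧ 0 < μ.rowLen n then 2 else 1
      else 0 := by
  have hU : ∀ i j, (i, j) ∈ ν.cells \ κ.cells ↔ κ.rowLen i ≤ j ∧ j < ν.rowLen i := fun i j => by
    simp only [Finset.mem_sdiff, YoungDiagram.mem_cells, YoungDiagram.mem_iff_lt_rowLen]
    omega
  have hV : ∀ i j, (i, j) ∈ μ.cells \ ν.cells ↔ ν.rowLen i ≤ j ∧ j < μ.rowLen i := fun i j => by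
    simp only [Finset.mem_sdiff, YoungDiagram.mem_cells, YoungDiagram.mem_iff_lt_rowLen]
    omega
  have hνμ := mem_hstrips_iff_rowLen.1 hν
  have hκν := mem_hstrips_iff_rowLen.1 hκ
  classical
  unfold pairFactor
  refine if_ctx_congr ?_ (fun _ => if_congr ?_ rfl rfl) fun _ => rfl
  · constructor
    · intro h
      by_contra! hc
      obtain ⟨h1, h2, h3⟩ := hc
      obtain ⟨⟨i, j⟩, hd, hi, hj⟩ := h ⟨(n, 0), (hU _ _).2 ⟨h0.le, Nat.pos_of_ne_zero h1⟩, rfl⟩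
        (n, ν.rowLen n) ((hV _ _).2 ⟨le_rfl, h2⟩) rfl
      simp only at hi hj
      rw [hU, hj] at hd
      rw [lastBound, if_neg (by omega), show n - 1 = i by omega] at h3
      omega
    · rintro h ⟨⟨i, j⟩, hb, rfl⟩ ⟨i', j'⟩ hc hi
      simp only at hi hb h h0 ⊢
      subst hi
      rw [hV] at hc
      rw [hU] at hb
      rcases h with h | h | h
      · omega
      · omega
      · rw [lastBound] at h
        split_ifs at h with hn
        · omega
        · have h1 := (hνμ (i' - 1)).1
          rw [Nat.sub_add_cancel (Nat.pos_of_ne_zero hn)] at h1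
          exact ⟨(i' - 1, j'), (hU _ _).2 ⟨by omega, by omega⟩, by simp only; omega, rfl⟩
  · constructor
    · rintro ⟨⟨i, j⟩, hc, ⟨i', j'⟩, hd, hj, hj', hi, hi'⟩
      simp only at hj hj' hi hi'
      subst hj hj' hi'
      rw [hU] at hc
      rw [hV] at hd
      rw [lastBound, if_neg (by omega), show i' - 1 = i by omega]
      omega
    · rintro ⟨h1, h2, h3⟩
      rw [lastBound] at h1
      split_ifs at h1 with hn
      · omega
      · have h4 := (hνμ (n - 1)).1
        rw [Nat.sub_add_cancel (Nat.pos_of_ne_zero hn)] at h4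
        exact ⟨(n - 1, 0), (hU _ _).2 ⟨by omega, by omega⟩, (n, 0), (hV _ _).2 ⟨by omega, h3⟩, rfl,
          rfl, Nat.sub_add_cancel (Nat.pos_of_ne_zero hn), rfl⟩

/-- Induction on the number of variables, as for the symplectic alternant, except that the
contributions of the last row agree only after summation over its possible contents. -/
theorem alternant_evenSeq (x : ℕ → K) (n : ℕ) (hx : ∀ i < n, x i ≠ 0) (A : ℤ → K)
    (hA : ∀ r ≤ 0, A r = 0) (μ : YoungDiagram) (hμ : μ.rowLen n = 0) :
    alternant n (fun i m => evenSeq A (x i) m) μ =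
      (∏ k ∈ Finset.range n, ∏ i ∈ Finset.range k, (x i + (x i)⁻¹ - (x k + (x k)⁻¹))) *
        evenSum (evenWeight x A n) n μ := by
  induction n generalizing A μ with
  | zero => simp [eq_bot_of_rowLen_zero hμ, evenSum_bot, alternant]
  | succ n ih =>
    have hzn := mul_inv_cancel₀ (hx n (Nat.lt_succ_self n))
    set z := x n with hz
    set C : K := ∏ k ∈ Finset.range (n + 1), ∏ i ∈ Finset.range k,
      (x i + (x i)⁻¹ - (x k + (x k)⁻¹)) with hC
    set D : ℕ → K := fun i => x i + (x i)⁻¹ - (z + z⁻¹) with hD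
    set f : ℕ → ℕ → K := fun i => delay fun m =>
      (x i - z⁻¹) * facPowInt A (x i) m + ((x i)⁻¹ - z⁻¹) * facPowInt A (x i)⁻¹ m with hf
    set g : ℕ → ℕ → K := fun i => delay fun m => D i * evenSeq (shift A) (x i) m with hg
    have hef : ∀ i < n + 1, ∀ m, evenSeq A (x i) (m + 1) =
        f i (m + 1) + evenBarMult A z (m + 1) * evenSeq A (x i) m := by
      intro i _ m
      rcases m with _ | m
      · simp [hf, evenSeq, evenBarMult, facPowInt]
        ring
      · simp only [hf, evenSeq, evenBarMult, delay_succ]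
        rw [if_neg (by omega), facPowInt_succ A _ (m + 1), facPowInt_succ A _ (m + 1)]
        push_cast
        ring
    have hfg : ∀ i < n + 1, ∀ m, f i (m + 1) = g i (m + 1) + evenPlainMult A z (m + 1) * f i m := by
      intro i hi m
      rcases m with _ | m
      · simp [hf, hg, hD, evenSeq, evenPlainMult]
        ring
      · have h1 := mul_inv_cancel₀ (hx i hi)
        have e : (((m + 1 + 1 : ℕ) : ℤ) - 1) = m + 1 := by push_cast; ring
        simp only [hf, hg, hD, evenSeq, evenPlainMult, delay_succ]
        rw [if_neg (by omega), facPowInt_shift (hA 0 le_rfl), facPowInt_shift (hA 0 le_rfl),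
          facPowInt_succ, facPowInt_succ, e]
        linear_combination (facPowInt A (x i) m + facPowInt A (x i)⁻¹ m) * (hzn - h1)
    have hred : ∀ κ : YoungDiagram, alternant (n + 1) g κ =
        if κ.rowLen n = 0 then C * evenSum (evenWeight x A (n + 1)) n κ else 0 := by
      intro κ
      rw [alternant_succ_eq (g := g) (by simp [g, D, z])]
      refine ite_congr rfl (fun h => ?_) fun _ => rfl
      have hC' : ∏ i ∈ Finset.range n, (x i + (x i)⁻¹ - (z + z⁻¹)) = ∏ i : Fin n, D i :=
        Finset.prod_range _
      simp only [g, delay_zero, delay_succ]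
      rw [alternant_mul D (fun i m => evenSeq (shift A) (x i) m),
        ih (fun i hi => hx i (by omega)) (shift A) (shift_of_nonpos hA) κ h, hC,
        Finset.prod_range_succ, ← hz, hC', evenSum_congr (w := evenWeight x (shift A) n)
          (w' := evenWeight x A (n + 1))]
      · ring
      · intro m c
        simp only [evenWeight, shift]
        push_cast
        ring_nf
    -- the part of a pair of strips outside the row with index `n`
    set L : (Fin n → ℕ) → YoungDiagram → K := fun r κ =>
      (∏ j : Fin n, ∏ c ∈ Finset.Ico (r j) (μ.rowLen j), (z⁻¹ + A ((c + 1 + (n - j) : ℕ) : ℤ))) *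
      (∏ j : Fin n, ∏ c ∈ Finset.Ico (κ.rowLen j) (r j), (z + A ((c + (n - j) : ℕ) : ℤ))) *
      (C * evenSum (evenWeight x A (n + 1)) n κ) with hL
    set b := μ.rowLen n with hb
    have hleft : alternant (n + 1) (fun i m => evenSeq A (x i) m) μ =
        ∑ ν ∈ hstrips μ, ∑ κ ∈ hstrips ν, if κ.rowLen n = 0 then
          L (fun i => ν.rowLen i) κ *
            ((∏ c ∈ Finset.Ico (ν.rowLen n) b, evenBarMult A z (c + 1)) *
              ∏ c ∈ Finset.Ico 0 (ν.rowLen n), evenPlainMult A z (c + 1)) else 0 := by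
      rw [alternant_eq_sum_hstrips (g := f) (w := evenBarMult A z) (by simp [f, evenSeq]) hef hμ]
      refine Finset.sum_congr rfl fun ν hν => ?_
      have hνn := rowLen_eq_zero_of_mem_hstrips hν hμ
      rw [alternant_eq_sum_hstrips (g := g) (w := evenPlainMult A z) (by simp [f, g]) hfg hνn,
        Finset.mul_sum]
      refine Finset.sum_congr rfl fun κ hκ => ?_
      rw [hred κ]
      split_ifs with h0
      · rw [prod_sdiff_eq hμ, prod_sdiff_eq hνn, Fin.prod_univ_castSucc, Fin.prod_univ_castSucc]
        simp only [Fin.val_castSucc, Fin.val_last, add_tsub_cancel_right, tsub_self, add_zero, h0]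
        have e1 : ∀ j : Fin n, ∀ c, evenBarMult A z (c + 1 + (n - j)) =
            z⁻¹ + A ((c + 1 + (n - j) : ℕ) : ℤ) := fun j c => by
          rw [evenBarMult, if_neg (by omega)]
        have e2 : ∀ j : Fin n, ∀ c, evenPlainMult A z (c + 1 + (n - j)) =
            z + A ((c + (n - j) : ℕ) : ℤ) := fun j c => by
          rw [evenPlainMult, if_neg (by omega)]
          congr 2
          omega
        simp only [e1, e2, hL]
        ring
      · ring
    have hright : C * evenSum (evenWeight x A (n + 1)) (n + 1) μ =
        ∑ ν ∈ hstrips μ, ∑ κ ∈ hstrips ν, if κ.rowLen n = 0 then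
          L (fun i => ν.rowLen i) κ *
            ((∏ c ∈ Finset.Ico (ν.rowLen n) b, (z⁻¹ + A (c + 1))) *
              (∏ c ∈ Finset.Ico 0 (ν.rowLen n), (z + A (c + 1))) *
              (if ν.rowLen n = 0 ∨ b ≤ ν.rowLen n ∨ lastBound n b κ ≤ ν.rowLen n then
                if lastBound n b κ = 0 ∧ ν.rowLen n = 0 ∧ 0 < b then 2 else 1 else 0)) else 0 := by
      rw [evenSum_succ, Finset.mul_sum]
      refine Finset.sum_congr rfl fun ν hν => ?_
      have hνn := rowLen_eq_zero_of_mem_hstrips hν hμ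
      rw [Finset.mul_sum]
      refine Finset.sum_congr rfl fun κ hκ => ?_
      by_cases h0 : κ.rowLen n = 0
      · rw [if_pos h0, pairFactor_eq hν hκ h0, prod_sdiff_eq hμ, prod_sdiff_eq hνn, Fin.prod_univ_castSucc,
          Fin.prod_univ_castSucc]
        simp only [Fin.val_castSucc, Fin.val_last, h0, ← hb]
        have hdiv1 : (2 * n + 1) / 2 = n := by omega
        have hdiv2 : 2 * n / 2 = n := by omega
        have e1 : ∀ j : Fin n, ∀ c, evenWeight x A (n + 1) (2 * n + 1) ((j : ℕ), c) =
            z⁻¹ + A ((c + 1 + (n - j) : ℕ) : ℤ) := fun j c => by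
          rw [evenWeight, hdiv1, if_pos j.2.le, if_neg (by omega), ← hz]
          congr 2
          simp only
          omega
        have e2 : ∀ j : Fin n, ∀ c, evenWeight x A (n + 1) (2 * n) ((j : ℕ), c) =
            z + A ((c + (n - j) : ℕ) : ℤ) := fun j c => by
          rw [evenWeight, hdiv2, if_pos j.2.le, if_pos (by omega), if_neg j.2.ne, ← hz]
          congr 2
          simp only
          omega
        have e3 : ∀ c, evenWeight x A (n + 1) (2 * n + 1) (n, c) = z⁻¹ + A (c + 1) := fun c => by
          rw [evenWeight, hdiv1, if_pos le_rfl, if_neg (by omega), ← hz]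
          congr 2
          simp only
          omega
        have e4 : ∀ c, evenWeight x A (n + 1) (2 * n) (n, c) = z + A (c + 1) := fun c => by
          rw [evenWeight, hdiv2, if_pos le_rfl, if_pos (by omega), if_pos rfl, ← hz]
          congr 2
          simp only
          omega
        simp only [e1, e2, e3, e4, hL]
        ring
      · rw [if_neg h0, evenSum_eq_zero (c := (n, 0))
          (YoungDiagram.mem_iff_lt_rowLen.2 (Nat.pos_of_ne_zero h0))
          fun m hm => by rw [evenWeight, if_neg (by simp only; omega)]]
        ring
    rw [hleft, hright]
    refine sum_hstrips_hstrips_congr hμ L (fun q _ =>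
      (∏ c ∈ Finset.Ico q b, evenBarMult A z (c + 1)) *
        ∏ c ∈ Finset.Ico 0 q, evenPlainMult A z (c + 1)) (fun q κ =>
      (∏ c ∈ Finset.Ico q b, (z⁻¹ + A (c + 1))) * (∏ c ∈ Finset.Ico 0 q, (z + A (c + 1))) *
        (if q = 0 ∨ b ≤ q ∨ lastBound n b κ ≤ q then
          if lastBound n b κ = 0 ∧ q = 0 ∧ 0 < b then 2 else 1 else 0)) fun κ => ?_
    rw [← hb]
    rcases Nat.eq_zero_or_pos b with h0 | hpos
    · simp [h0]
    · rw [sum_evenMult A z hpos (min_le_left _ _), sum_lastRow A z⁻¹ z hpos]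

end EvenAlternant

/-! ### Even orthogonal characters as sums over coded tableaux -/

section Characters

variable {K : Type*} [Field K] {n : ℕ} {μ : YoungDiagram}

theorem mem_letterBoxes_plain {T : Filling μ (Letter n)} {k : Fin n} {c : ℕ × ℕ} :
    c ∈ letterBoxes (fun c => letterCode (T c)) (2 * (k : ℕ)) ↔
      ∃ h : c ∈ μ.cells, T ⟨c, h⟩ = Letter.plain k := by
  rw [mem_letterBoxes]
  refine exists_congr fun h => ?_
  rw [← letterCode_strictMono.injective.eq_iff]
  rfl

theorem mem_letterBoxes_bar {T : Filling μ (Letter n)} {k : Fin n} {c : ℕ × ℕ} :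
    c ∈ letterBoxes (fun c => letterCode (T c)) (2 * (k : ℕ) + 1) ↔
      ∃ h : c ∈ μ.cells, T ⟨c, h⟩ = Letter.bar k := by
  rw [mem_letterBoxes]
  refine exists_congr fun h => ?_
  rw [← letterCode_strictMono.injective.eq_iff]
  rfl

theorem T6_iff {T : Filling μ (Letter n)} : T6 T ↔ ∀ k : Fin n,
    Covers k (letterBoxes (fun c => letterCode (T c)) (2 * (k : ℕ)))
      (letterBoxes (fun c => letterCode (T c)) (2 * (k : ℕ) + 1)) := by
  refine forall_congr' fun k => ?_
  constructor
  · rintro h ⟨b, hb, hbk⟩ c hc hck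
    obtain ⟨hb', hbT⟩ := mem_letterBoxes_plain.1 hb
    obtain ⟨hc', hcT⟩ := mem_letterBoxes_bar.1 hc
    obtain ⟨d, hrow, hcol, hd⟩ := h ⟨⟨b, hb'⟩, congrArg Nat.succ hbk, hbT⟩ ⟨c, hc'⟩
      (congrArg Nat.succ hck) hcT
    simp only [row, col] at hrow hcol
    exact ⟨d.1, mem_letterBoxes_plain.2 ⟨d.2, hd⟩, by omega, by omega⟩
  · rintro h ⟨b, hbk, hb⟩ c hck hc
    simp only [row] at hbk hck
    obtain ⟨d, hd, hrow, hcol⟩ := h ⟨b.1, mem_letterBoxes_plain.2 ⟨b.2, hb⟩, by omega⟩ c.1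
      (mem_letterBoxes_bar.2 ⟨c.2, hc⟩) (by omega)
    obtain ⟨hd', hdT⟩ := mem_letterBoxes_plain.1 hd
    refine ⟨⟨d, hd'⟩, ?_, ?_, hdT⟩ <;> simp only [row, col] <;> omega

theorem doubles_iff {T : Filling μ (Letter n)} {k : Fin n} :
    Doubles k (letterBoxes (fun c => letterCode (T c)) (2 * (k : ℕ)))
      (letterBoxes (fun c => letterCode (T c)) (2 * (k : ℕ) + 1)) ↔
    ∃ c d : μ.cells, col c = 1 ∧ col d = 1 ∧
      row c = (k : ℕ) ∧ row d = (k : ℕ) + 1 ∧ T c = Letter.plain k ∧ T d = Letter.bar k := by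
  simp only [row, col]
  constructor
  · rintro ⟨c, hc, d, hd, h1, h2, h3, h4⟩
    obtain ⟨hc', hcT⟩ := mem_letterBoxes_plain.1 hc
    obtain ⟨hd', hdT⟩ := mem_letterBoxes_bar.1 hd
    exact ⟨⟨c, hc'⟩, ⟨d, hd'⟩, by simp only; omega, by simp only; omega, h3, by simp only; omega,
      hcT, hdT⟩
  · rintro ⟨c, d, h1, h2, h3, h4, hc, hd⟩
    exact ⟨c.1, mem_letterBoxes_plain.2 ⟨c.2, hc⟩, d.1, mem_letterBoxes_bar.2 ⟨d.2, hd⟩, by omega,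
      by omega, h3, by omega⟩

theorem prod_pairFactor (T : Filling μ (Letter n)) [Decidable (T6 T)] :
    ∏ k ∈ Finset.range n, pairFactor K k (letterBoxes (fun c => letterCode (T c)) (2 * k))
      (letterBoxes (fun c => letterCode (T c)) (2 * k + 1)) =
    if T6 T then 2 ^ zeta T else 0 := by
  classical
  rw [Finset.prod_range]
  simp only [pairFactor]
  rw [Finset.prod_ite_zero]
  by_cases h6 : T6 T
  swap
  · rw [if_neg h6, if_neg]
    simpa [T6_iff] using h6
  rw [if_pos h6, if_pos fun k _ => T6_iff.1 h6 k, ← Finset.prod_filter_mul_prod_filter_not Finset.univ (fun k : Fin n => Doubles k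
    (letterBoxes (fun c => letterCode (T c)) (2 * (k : ℕ)))
    (letterBoxes (fun c => letterCode (T c)) (2 * (k : ℕ) + 1))),
    Finset.prod_congr rfl fun k hk => if_pos (Finset.mem_filter.1 hk).2,
    Finset.prod_congr rfl fun k hk => if_neg (Finset.mem_filter.1 hk).2,
    Finset.prod_const, Finset.prod_const_one, mul_one, zeta]
  congr 2
  ext k
  simp only [Finset.mem_filter, Finset.mem_univ, true_and, doubles_iff]

theorem prod_evenWeight (x : Fin n → K) (a : ℕ+ → K) (T : Filling μ (Letter n))
    [Decidable (T4 T)] :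
    ∏ c, evenWeight (extendVars x) (ext a) n (letterCode (T c)) c.1 =
      if T4 T then ∏ c : μ.cells, eoWeight x a c (T c) else 0 := by
  split_ifs with h
  · refine Finset.prod_congr rfl fun c _ => ?_
    have hc := h c
    have e : ((col c : ℤ) - row c) = (c.1.2 : ℤ) - c.1.1 := by
      simp only [row, col]
      push_cast
      ring
    have e' : row c = ((T c).idx : ℕ) + 1 ↔ c.1.1 = ((T c).idx : ℕ) := by
      rw [row]
      omega
    rw [row] at hc
    rw [evenWeight, letterCode_div, letterCode_mod, if_pos (by omega), extendVars_val, eoWeight]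
    cases (T c).isBar
    · simp only [Bool.false_eq_true, if_false, if_true, add_sub_assoc, e, e']
    · simp only [if_true, one_ne_zero, if_false, add_sub_assoc, e]
  · obtain ⟨c, hc⟩ := not_forall.1 h
    rw [row] at hc
    refine Finset.prod_eq_zero (Finset.mem_univ c) ?_
    rw [evenWeight, letterCode_div, if_neg (by omega)]

theorem sum_eoTableaux (x : Fin n → K) (a : ℕ+ → K) :
    ∑ T ∈ eoTableaux μ n, 2 ^ zeta T * ∏ c, eoWeight x a c (T c) =
      evenSum (evenWeight (extendVars x) (ext a) n) n μ := by
  classical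
  refine sum_eq_sum_monoFillings letterCode_strictMono lt_two_mul_iff
    (fun T => T3 T ∧ T4 T ∧ T6 T) (by simp [eoTableaux, and_assoc]) _ _ ?_
  intro T _
  simp only [T3_comp_iff letterCode_strictMono, prod_evenWeight, prod_pairFactor, ite_and]
  refine ite_congr rfl (fun _ => ?_) fun _ => rfl
  split_ifs <;> ring

/-! ### The four characters -/

theorem alternant_extendVars (f : K → ℕ → K) (x : Fin n → K) (μ : YoungDiagram) :
    alternant n (fun i m => f (extendVars x i) m) μ =
      (Matrix.of fun i j : Fin n => f (x i) (μ.rowLen j + (n - 1 - j))).det := by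
  simp [alternant]

theorem alternant_extendVars_bot (f : K → ℕ → K) (x : Fin n → K) :
    alternant n (fun i m => f (extendVars x i) m) ⊥ =
      (Matrix.of fun i j : Fin n => f (x i) (n - 1 - j)).det := by
  simp [alternant, rowLen_bot]

theorem vstrips_bot : vstrips ⊥ = {⊥} := by
  ext ν
  rw [mem_vstrips, Finset.mem_singleton, le_bot_iff]
  exact ⟨fun h => h.1, fun h => ⟨h, fun i c hc => absurd hc (YoungDiagram.notMem_bot _)⟩⟩

theorem prod_prod_sub_ne_zero {u : ℕ → K} (hu : ∀ i < n, ∀ k < n, i ≠ k → u i ≠ u k) :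
    ∏ k ∈ Finset.range n, ∏ i ∈ Finset.range k, (u i - u k) ≠ 0 := by
  refine Finset.prod_ne_zero_iff.2 fun k hk => Finset.prod_ne_zero_iff.2 fun i hi => ?_
  rw [Finset.mem_range] at hk hi
  exact sub_ne_zero.2 (hu i (hi.trans hk) k hk hi.ne)

theorem gl_eq_sum (hμ : μ.rowLen n = 0) (x : Fin n → K) (a : ℕ+ → K)
    (hx : ∀ i j, i ≠ j → x i ≠ x j) :
    gl μ x a = ∑ T ∈ glTableaux μ n, ∏ c, glWeight x a c (T c) := by
  have h (ν : YoungDiagram) (hν : ν.rowLen n = 0) :=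
    alternant_facPowInt (extendVars x) (ext a) n ν hν
  have hC := prod_prod_sub_ne_zero (u := extendVars x) (n := n) fun i hi k hk hik => by
    simpa [extendVars, hi, hk] using hx ⟨i, hi⟩ ⟨k, hk⟩ (by simpa using hik)
  have h1 := h μ hμ
  have h2 := h ⊥ (rowLen_bot n)
  rw [ssytSum_bot, mul_one, alternant_extendVars_bot (facPowInt (ext a))] at h2
  rw [alternant_extendVars (facPowInt (ext a))] at h1
  simp only [facPowInt_ext] at h1 h2
  rw [sum_glTableaux, gl, h1, h2, mul_div_cancel_left₀ _ hC]

theorem prod_prod_add_inv_sub_ne_zero {x : Fin n → K}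
    (hu : ∀ i j, i ≠ j → x i + (x i)⁻¹ ≠ x j + (x j)⁻¹) :
    ∏ k ∈ Finset.range n, ∏ i ∈ Finset.range k, (extendVars x i + (extendVars x i)⁻¹ -
      (extendVars x k + (extendVars x k)⁻¹)) ≠ 0 :=
  prod_prod_sub_ne_zero (u := fun i => extendVars x i + (extendVars x i)⁻¹) fun i hi k hk hik => by
    simpa [extendVars, hi, hk] using hu ⟨i, hi⟩ ⟨k, hk⟩ (by simpa using hik)

theorem extendVars_ne_zero {x : Fin n → K} (hx : ∀ i, x i ≠ 0) (i : ℕ) (hi : i < n) :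
    extendVars x i ≠ 0 := by
  simpa [extendVars, hi] using hx ⟨i, hi⟩

theorem sp_eq_sum (hμ : μ.rowLen n = 0) (x : Fin n → K) (a : ℕ+ → K) (hx : ∀ i, x i ≠ 0)
    (hx' : ∀ i, x i ≠ (x i)⁻¹) (hu : ∀ i j, i ≠ j → x i + (x i)⁻¹ ≠ x j + (x j)⁻¹) :
    sp μ x a = ∑ T ∈ spTableaux μ n, ∏ c, spWeight x a c (T c) := by
  have hA : ∀ r ≤ 0, ext a r = 0 := fun r hr => ext_of_nonpos a hr
  have hentry (y : K) (m : ℕ) : y * facPow y a m - y⁻¹ * facPow y⁻¹ a m =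
      (y - y⁻¹) * facHom (shift (ext a)) y m := by
    rw [sub_mul_facHom, facPowInt_shift (hA 0 le_rfl), facPowInt_shift (hA 0 le_rfl), facPowInt_ext,
      facPowInt_ext]
  have h (ν : YoungDiagram) (hν : ν.rowLen n = 0) :=
    alternant_facHom (extendVars x) n (extendVars_ne_zero hx) (shift (ext a))
      (shift_of_nonpos hA) ν hν
  have hC := prod_prod_add_inv_sub_ne_zero hu
  have hC' : ∏ i, (x i - (x i)⁻¹) ≠ 0 :=
    Finset.prod_ne_zero_iff.2 fun i _ => sub_ne_zero.2 (hx' i)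
  have h1 := h μ hμ
  have h2 := h ⊥ (rowLen_bot n)
  rw [ssytSum_bot, mul_one, alternant_extendVars_bot (facHom (shift (ext a)))] at h2
  rw [alternant_extendVars (facHom (shift (ext a)))] at h1
  have e1 := Matrix.det_mul_column (fun i => x i - (x i)⁻¹)
    (Matrix.of fun i j : Fin n => facHom (shift (ext a)) (x i) (μ.rowLen j + (n - 1 - j)))
  have e2 := Matrix.det_mul_column (fun i => x i - (x i)⁻¹)
    (Matrix.of fun i j : Fin n => facHom (shift (ext a)) (x i) (n - 1 - j))
  simp only [Matrix.of_apply] at e1 e2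
  simp only [sp, hentry]
  rw [sum_spTableaux, e1, e2, h1, h2, mul_div_mul_left _ _ hC', mul_div_cancel_left₀ _ hC]

theorem so_eq_sum (hμ : μ.rowLen n = 0) (x s : Fin n → K) (a : ℕ+ → K) (hx : ∀ i, x i ≠ 0)
    (hx' : ∀ i, x i ≠ 1) (hu : ∀ i j, i ≠ j → x i + (x i)⁻¹ ≠ x j + (x j)⁻¹)
    (hs : ∀ i, s i ^ 2 = x i) :
    so μ x s a = ∑ T ∈ ooTableaux μ n, ∏ c, ooWeight x a c (T c) := by
  have hA : ∀ r ≤ 0, ext a r = 0 := fun r hr => ext_of_nonpos a hr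
  set f : K → ℕ → K := fun y => delay fun m =>
    facHom (ext a) y (m + 1) + (1 - ext a (m + 2)) * facHom (ext a) y m with hf
  have hentry (i : Fin n) (m : ℕ) :
      s i * facPow (x i) a m - (s i)⁻¹ * facPow (x i)⁻¹ a m = (s i - (s i)⁻¹) * f (x i) m := by
    rcases m with _ | m
    · simp [hf, facPow]
    · simp only [hf, delay_succ]
      rw [sub_mul_facHom_add (hx i) (hs i), facPowInt_ext, facPowInt_ext]
  have h (ν : YoungDiagram) (hν : ν.rowLen n = 0) :
      alternant n (fun i m => f (extendVars x i) m) ν =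
        (∏ k ∈ Finset.range n, ∏ i ∈ Finset.range k, (extendVars x i + (extendVars x i)⁻¹ -
          (extendVars x k + (extendVars x k)⁻¹))) *
        ∑ T ∈ ooTableaux ν n, ∏ c, ooWeight x a c (T c) := by
    rw [sum_ooTableaux, Finset.mul_sum]
    refine (alternant_facHom_add (extendVars x) n (ext a) ν hν).trans ?_
    refine Finset.sum_congr rfl fun κ hκ => ?_
    have hκn : κ.rowLen n = 0 := Nat.le_zero.1 (hν ▸ (mem_vstrips_iff_rowLen.1 hκ n).2)
    rw [alternant_facHom (extendVars x) n (extendVars_ne_zero hx) (ext a) hA κ hκn]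
    ring
  have hC := prod_prod_add_inv_sub_ne_zero hu
  have hC' : ∏ i, (s i - (s i)⁻¹) ≠ 0 := by
    refine Finset.prod_ne_zero_iff.2 fun i _ => sub_ne_zero.2 fun heq => hx' i ?_
    have hs0 : s i ≠ 0 := fun h0 => hx i (by rw [← hs i, h0]; simp)
    rw [← hs i, sq]
    nth_rw 2 [heq]
    exact mul_inv_cancel₀ hs0
  have h1 := h μ hμ
  have h2 := h ⊥ (rowLen_bot n)
  rw [sum_ooTableaux, vstrips_bot, Finset.sum_singleton, ssytSum_bot, sdiff_self, mul_one,
    alternant_extendVars_bot f] at h2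
  rw [alternant_extendVars f] at h1
  have e1 := Matrix.det_mul_column (fun i => s i - (s i)⁻¹)
    (Matrix.of fun i j : Fin n => f (x i) (μ.rowLen j + (n - 1 - j)))
  have e2 := Matrix.det_mul_column (fun i => s i - (s i)⁻¹)
    (Matrix.of fun i j : Fin n => f (x i) (n - 1 - j))
  simp only [Matrix.of_apply] at e1 e2
  simp only [so, hentry]
  rw [e1, e2, h1, h2, mul_div_mul_left _ _ hC']
  simp only [Finset.bot_eq_empty, Finset.prod_empty, mul_one]
  rw [mul_div_cancel_left₀ _ hC]

/-- The factor `η` compensates for the last column, all of whose entries are equal to `2` if the last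
part of the partition is zero. -/
theorem det_facPow_add_eq (hn : 0 < n) (x : Fin n → K) (a : ℕ+ → K) (μ : YoungDiagram) :
    (Matrix.of fun i j : Fin n => facPow (x i) a (μ.rowLen j + (n - 1 - j)) +
        facPow (x i)⁻¹ a (μ.rowLen j + (n - 1 - j))).det =
      (if μ.rowLen (n - 1) = 0 then 2 else 1) *
        alternant n (fun i m => evenSeq (ext a) (extendVars x i) m) μ := by
  rw [alternant_extendVars (evenSeq (ext a))]
  obtain ⟨n, rfl⟩ : ∃ m, n = m + 1 := ⟨n - 1, by omega⟩
  have e := Matrix.det_mul_row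
    (fun j : Fin (n + 1) => if μ.rowLen j + (n + 1 - 1 - j) = 0 then (2 : K) else 1)
    (Matrix.of fun i j : Fin (n + 1) => evenSeq (ext a) (x i) (μ.rowLen j + (n + 1 - 1 - j)))
  have hprod : ∏ j : Fin (n + 1), (if μ.rowLen j + (n + 1 - 1 - j) = 0 then (2 : K) else 1) =
      if μ.rowLen (n + 1 - 1) = 0 then 2 else 1 := by
    rw [Fin.prod_univ_castSucc, Finset.prod_eq_one fun j _ => if_neg (by simp; omega), one_mul]
    simp
  rw [hprod] at e
  rw [← e]
  congr 1
  ext i j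
  simp only [Matrix.of_apply]
  rcases μ.rowLen j + (n + 1 - 1 - j) with _ | m
  · simp [evenSeq, facPow]
    norm_num
  · simp [evenSeq, facPowInt_ext]

theorem o_eq_sum (hn : 0 < n) (hμ : μ.rowLen n = 0) (x : Fin n → K) (a : ℕ+ → K)
    (h2 : (2 : K) ≠ 0) (hx : ∀ i, x i ≠ 0)
    (hu : ∀ i j, i ≠ j → x i + (x i)⁻¹ ≠ x j + (x j)⁻¹) :
    o μ x a = ∑ T ∈ eoTableaux μ n, 2 ^ zeta T * ∏ c, eoWeight x a c (T c) := by
  have hA : ∀ r ≤ 0, ext a r = 0 := fun r hr => ext_of_nonpos a hr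
  have hC := prod_prod_add_inv_sub_ne_zero hu
  have h (ν : YoungDiagram) (hν : ν.rowLen n = 0) :=
    alternant_evenSeq (extendVars x) n (extendVars_ne_zero hx) (ext a) hA ν hν
  have hnum := det_facPow_add_eq hn x a μ
  have hden := det_facPow_add_eq hn x a ⊥
  rw [h μ hμ] at hnum
  rw [h ⊥ (rowLen_bot n), evenSum_bot, if_pos (rowLen_bot _), mul_one] at hden
  simp only [rowLen_bot, zero_add] at hden
  rw [o, hnum, hden, sum_eoTableaux]
  generalize ∏ k ∈ Finset.range n, ∏ i ∈ Finset.range k, (extendVars x i + (extendVars x i)⁻¹ -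
    (extendVars x k + (extendVars x k)⁻¹)) = C at hC ⊢
  split_ifs
  · field_simp
  · field_simp

end Characters

end FactorialCharacter

/-- The factorial characters are evaluated at arbitrary elements of an arbitrary field, subject to
the Weyl denominators (the denominators of the defining ratios) being nonzero; taking a field of
rational functions gives the identities between formal characters. In the odd orthogonal case `s` is
any choice of square roots of the `x_i`, and in the even orthogonal case `2` has to be
invertible. -/
theorem theorem2 {K : Type*} [Field K] (n : ℕ) (hn : 0 < n)
    (μ : YoungDiagram) (hμ : μ.colLen 0 ≤ n) (x : Fin n → K) (a : ℕ+ → K) :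
    ((∀ i j, i ≠ j → x i ≠ x j) →
      FactorialCharacter.gl μ x a =
        ∑ T ∈ FactorialCharacter.glTableaux μ n, ∏ c, FactorialCharacter.glWeight x a c (T c)) ∧
    ((∀ i, x i ≠ 0) → (∀ i, x i ≠ 1) →
      (∀ i j, i ≠ j → x i + (x i)⁻¹ ≠ x j + (x j)⁻¹) →
      ∀ s : Fin n → K, (∀ i, s i ^ 2 = x i) →
      FactorialCharacter.so μ x s a =
        ∑ T ∈ FactorialCharacter.ooTableaux μ n, ∏ c, FactorialCharacter.ooWeight x a c (T c)) ∧
    ((∀ i, x i ≠ 0) → (∀ i, x i ≠ (x i)⁻¹) →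
      (∀ i j, i ≠ j → x i + (x i)⁻¹ ≠ x j + (x j)⁻¹) →
      FactorialCharacter.sp μ x a =
        ∑ T ∈ FactorialCharacter.spTableaux μ n, ∏ c, FactorialCharacter.spWeight x a c (T c)) ∧
    ((2 : K) ≠ 0 → (∀ i, x i ≠ 0) →
      (∀ i j, i ≠ j → x i + (x i)⁻¹ ≠ x j + (x j)⁻¹) →
      FactorialCharacter.o μ x a =
        ∑ T ∈ FactorialCharacter.eoTableaux μ n,
          2 ^ FactorialCharacter.zeta T * ∏ c, FactorialCharacter.eoWeight x a c (T c)) := by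
  have hμ' : μ.rowLen n = 0 := FactorialCharacter.rowLen_eq_zero_iff.2 hμ
  exact ⟨FactorialCharacter.gl_eq_sum hμ' x a,
    fun hx hx' hu s hs => FactorialCharacter.so_eq_sum hμ' x s a hx hx' hu hs,
    FactorialCharacter.sp_eq_sum hμ' x a,
    FactorialCharacter.o_eq_sum hn hμ' x a⟩
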